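/- Let $\mathcal N_0\subset\mathbb R^3$ be a finite connected metric graph embedded in $\mathbb R^3$ with straight edges: there are a finite connected simple graph $(V,E)$ and an injective map $V\to\mathbb R^3$, each edge is identified isometrically with the segment between the images of its end points, two different edges meet at most in common end points, and $\mathcal N_0$ is the union of all vertices and edges. For $\varepsilon\ge 0$ let $$\mathcal N_\varepsilon=\mathcal N_0+\{x\in\mathbb R^3:\|x\|_2\le\varepsilon\}$$ (Minkowski sum), let $\iota_{\mathcal N_\varepsilon}$ be $0$ on $\mathcal N_\varepsilon$ and $+\infty$ outside, and define $c_\varepsilon:\mathbb R^3\times\mathbb R^3\to[0,+\infty]$ by $$c_\varepsilon(x,y)=\inf_{\gamma}\int_0^1\Big(\|\dot\gamma_t\|^2+\iota_{\mathcal N_\varepsilon}(\gamma_t)\Big)\,dt,$$ where the infimum is over all continuous, piecewise continuously differentiable curves $\gamma:[0,1]\to\mathbb R^3$ with $\gamma_0=x$, $\gamma_1=y$. For Borel probability measures $\mu,\nu$ on $\mathbb R^3$ let $$\operatorname{OT}(\mu,\nu,c_\varepsilon)=\inf_{\pi\in\Pi(\mu,\nu)}\int_{\mathbb R^3\times\mathbb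 R^3}c_\varepsilon\,d\pi,$$ where $\Pi(\mu,\nu)$ is the set of couplings of $\mu$ and $\nu$. Proposition. Let $(\mu_\varepsilon)_{\varepsilon>0}$ and $(\nu_\varepsilon)_{\varepsilon>0}$ be families of probability measures on $\mathbb R^3$ that are absolutely continuous with respect to Lebesgue measure, with $\operatorname{spt}\mu_\varepsilon\subseteq\mathcal N_\varepsilon$ and $\operatorname{spt}\nu_\varepsilon\subseteq\mathcal N_\varepsilon$. Assume that, as $\varepsilon\to0$, they converge weakly to probability measures $\mu_0$ and $\nu_0$, respectively, which are supported on $\mathcal N_0$ and atomless (every measurable set $A$ of positive measure contains a measurable set $B$ whose measure is positive and strictly smaller than that of $A$). Then $$\operatorname{OT}(\mu_\varepsilon,\nu_\varepsilon,c_\varepsilon)\longrightarrow\operatorname{OT}(\mu_0,\nu_0,c_0)\qquad\text{as }\varepsilon\to0.$$ -/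

import Mathlib

open Set Filter Topology MeasureTheory
open scoped ENNReal Pointwise

/-- Euclidean space `ℝ³`. -/
abbrev E3 : Type := EuclideanSpace ℝ (Fin 3)

/-- A connected metric graph with vertex set `V`, embedded in `ℝ³` with straight edges: the
interval `[0, ℓ]` of an edge `uv` is identified isometrically with the segment from `pos u` to
`pos v` (so `ℓ` is the distance of the two end points), and two different edges meet at most in
the common end points. -/
structure EmbeddedMetricGraph (V : Type*) where
  graph : SimpleGraph V
  connected : graph.Connected
  pos : V → E3
  pos_injective : Function.Injective pos
  segment_inter_segment : ∀ u v u' v' : V, graph.Adj u v → graph.Adj u' v' →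
    s(u, v) ≠ s(u', v') →
    segment ℝ (pos u) (pos v) ∩ segment ℝ (pos u') (pos v') ⊆
      pos '' (({u, v} : Set V) ∩ {u', v'})

/-- The subset of `ℝ³` occupied by the embedded graph: all its vertices and edges. -/
def EmbeddedMetricGraph.carrier {V : Type*} (G : EmbeddedMetricGraph V) : Set E3 :=
  range G.pos ∪ {x | ∃ u v : V, G.graph.Adj u v ∧ x ∈ segment ℝ (G.pos u) (G.pos v)}

/-- The network `N_ε`: the Minkowski sum of the embedded graph and the closed ball of radius `ε`
about the origin. For `ε = 0` it is the embedded graph itself. -/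
def EmbeddedMetricGraph.network {V : Type*} (G : EmbeddedMetricGraph V) (ε : ℝ) : Set E3 :=
  G.carrier + Metric.closedBall (0 : E3) ε

open Classical in
/-- The penalty function of a set: `0` on the set and `+∞` outside. -/
noncomputable def penalty (U : Set E3) (x : E3) : ℝ≥0∞ := if x ∈ U then 0 else ⊤

/-- Continuous and piecewise continuously differentiable on `[0, 1]`: there is a finite partition
`0 = t₀ < t₁ < ⋯ < tₙ = 1` such that the curve is `C¹` on each closed piece `[tᵢ, tᵢ₊₁]`. -/
def IsPiecewiseC1 (γ : ℝ → E3) : Prop :=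
  ContinuousOn γ (Icc 0 1) ∧
    ∃ (n : ℕ) (t : ℕ → ℝ), t 0 = 0 ∧ t n = 1 ∧
      ∀ i < n, t i < t (i + 1) ∧ ContDiffOn ℝ 1 γ (Icc (t i) (t (i + 1)))

/-- The piecewise continuously differentiable curves on `[0, 1]` from `x` to `y` (only their
values on `[0, 1]` matter). -/
def curves (x y : E3) : Set (ℝ → E3) := {γ | IsPiecewiseC1 γ ∧ γ 0 = x ∧ γ 1 = y}

/-- The action `∫₀¹ ‖γ'(t)‖² + ι_U(γ(t)) dt`. -/
noncomputable def action (U : Set E3) (γ : ℝ → E3) : ℝ≥0∞ :=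
  ∫⁻ t in Icc (0 : ℝ) 1, (‖deriv γ t‖ₑ ^ 2 + penalty U (γ t))

/-- The cost `c_ε(x, y)`: the infimum of the action with respect to `N_ε` over all curves from
`x` to `y`. -/
noncomputable def EmbeddedMetricGraph.cost {V : Type*} (G : EmbeddedMetricGraph V) (ε : ℝ)
    (x y : E3) : ℝ≥0∞ :=
  ⨅ γ ∈ curves x y, action (G.network ε) γ

/-- The couplings of `μ` and `ν`: Borel measures on `ℝ³ × ℝ³` with marginals `μ` and `ν`. -/
def couplings (μ ν : Measure E3) : Set (Measure (E3 × E3)) := {π | π.fst = μ ∧ π.snd = ν}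

/-- The optimal transport cost of `μ` and `ν` for the ground cost `c`. -/
noncomputable def OT (μ ν : Measure E3) (c : E3 → E3 → ℝ≥0∞) : ℝ≥0∞ :=
  ⨅ π ∈ couplings μ ν, ∫⁻ z, c z.1 z.2 ∂π

/-- Each `μ`-measurable set of positive measure has a `μ`-measurable subset of strictly smaller,
positive measure. -/
def IsAtomless (μ : Measure E3) : Prop :=
  ∀ A : Set E3, NullMeasurableSet A μ → 0 < μ A →
    ∃ B ⊆ A, NullMeasurableSet B μ ∧ 0 < μ B ∧ μ B < μ A

/-! The proof combines uniform closeness of the costs `c_ε` and `c_0` with a comparison of transport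
problems on a finite partition into small cells.

Costs. Curves in the graph are admissible in `N_ε`. Conversely, a curve in `N_ε` is pushed into the
graph by a `C¹` map whose derivative has norm at most `1 + η` (`exists_retraction`), so its action
grows by at most the factor `(1 + η)²` (`costOn_map_le`). Near one edge this map is the orthogonal
projection to the line of the edge followed by a reparametrisation that collapses neighbourhoods of
the end points. Near a vertex the maps of all its edges are therefore the same constant, and they
glue to a `C¹` map. End points are corrected by short extra pieces: a piece of cost `l²` run in the
fraction `l` of the time contributes only `l` (`costOn_triangle`, `exists_costOn_le_add`). Hence
`c_ε(x, y)` and `c_0(x', y')` differ by at most `δ` once `ε`, `dist x x'` and `dist y y'` are small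
(`exists_cost_close`).

Transport. A compact neighbourhood of the graph is cut into finitely many small cells whose
boundaries are null for both limit measures (`exists_cells`), so the cell masses converge. A
coupling of one pair of marginals gives a matrix of masses on pairs of cells. The matrix is adjusted
to the masses of the other pair and realised by a coupling of that pair. The loss is `δ` plus a
bound of the cost times the total change of mass (`OT_le_of_cells`). Applied in both directions this
gives the limit, with no compactness of couplings and no measurability of the costs. -/

/-! ### Transfer of couplings along a finite partition -/

open Finset in
/-- A coupling matrix can be transferred to nearby marginals at a cost controlled by the distance
of the marginals. -/
theorem exists_coupling_matrix {ι κ : Type*} [Fintype ι] [Fintype κ] (w : ι → κ → ℝ)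
    (p : ι → ℝ) (q : κ → ℝ) (p' : ι → ℝ) (q' : κ → ℝ)
    (hw : ∀ i j, 0 ≤ w i j) (hwp : ∀ i, ∑ j, w i j = p i) (hwq : ∀ j, ∑ i, w i j = q j)
    (hp : ∑ i, p i = 1) (hp'0 : ∀ i, 0 ≤ p' i) (hq'0 : ∀ j, 0 ≤ q' j)
    (hp' : ∑ i, p' i = 1) (hq' : ∑ j, q' j = 1) :
    ∃ w' : ι → κ → ℝ, (∀ i j, 0 ≤ w' i j) ∧ (∀ i, ∑ j, w' i j = p' i) ∧
      (∀ j, ∑ i, w' i j = q' j) ∧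
      ∀ (M : ℝ) (s : ι → κ → ℝ), (∀ i j, 0 ≤ s i j) → (∀ i j, s i j ≤ M) →
        ∑ i, ∑ j, s i j * w' i j ≤ ∑ i, ∑ j, s i j * w i j +
          M * (∑ i, |p i - p' i| + ∑ j, |q j - q' j|) := by
  have hp0 : ∀ i, 0 ≤ p i := fun i => hwp i ▸ sum_nonneg fun j _ => hw i j
  have hq0 : ∀ j, 0 ≤ q j := fun j => hwq j ▸ sum_nonneg fun i _ => hw i j
  have key : ∀ x y : ℝ, 0 ≤ x → 0 ≤ y →
      0 ≤ min 1 (y / x) ∧ min 1 (y / x) ≤ 1 ∧ x * min 1 (y / x) ≤ y ∧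
        x * (1 - min 1 (y / x)) ≤ |x - y| := by
    intro x y hx hy
    refine ⟨le_min zero_le_one (div_nonneg hy hx), min_le_left _ _, ?_, ?_⟩
    · rcases hx.eq_or_lt with rfl | hx
      · simpa using hy
      · calc x * min 1 (y / x) ≤ x * (y / x) := by gcongr; exact min_le_right _ _
          _ = y := by field_simp
    · rcases hx.eq_or_lt with rfl | hx
      · simp
      · rcases min_choice 1 (y / x) with h | h
        · rw [h]; simp
        · rw [h, mul_sub, mul_div_cancel₀ _ hx.ne', mul_one]; exact le_abs_self _
  -- Scaling rows by `a` and columns by `b` pushes both marginals of `w` below `p'` and `q'`. The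
  -- deficits `r` and `t` then have the same total `D`, the mass still to be placed.
  set a : ι → ℝ := fun i => min 1 (p' i / p i) with ha
  set b : κ → ℝ := fun j => min 1 (q' j / q j) with hb
  have hA : ∀ i, _ := fun i => key (p i) (p' i) (hp0 i) (hp'0 i)
  have hB : ∀ j, _ := fun j => key (q j) (q' j) (hq0 j) (hq'0 j)
  have h0 : ∀ i j, 0 ≤ w i j * a i * b j := fun i j =>
    mul_nonneg (mul_nonneg (hw i j) (hA i).1) (hB j).1
  set r : ι → ℝ := fun i => p' i - ∑ j, w i j * a i * b j with hr
  set t : κ → ℝ := fun j => q' j - ∑ i, w i j * a i * b j with ht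
  have hr0 : ∀ i, 0 ≤ r i := fun i => by
    refine sub_nonneg.2 (le_trans ?_ (hA i).2.2.1)
    calc ∑ j, w i j * a i * b j ≤ ∑ j, w i j * a i := sum_le_sum fun j _ =>
          mul_le_of_le_one_right (mul_nonneg (hw i j) (hA i).1) (hB j).2.1
      _ = p i * a i := by rw [← sum_mul, hwp]
  have ht0 : ∀ j, 0 ≤ t j := fun j => by
    refine sub_nonneg.2 (le_trans ?_ (hB j).2.2.1)
    calc ∑ i, w i j * a i * b j ≤ ∑ i, w i j * b j := sum_le_sum fun i _ =>
          mul_le_mul_of_nonneg_right (mul_le_of_le_one_right (hw i j) (hA i).2.1) (hB j).1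
      _ = q j * b j := by rw [← sum_mul, hwq]
  set D : ℝ := 1 - ∑ i, ∑ j, w i j * a i * b j with hD
  have hrD : ∑ i, r i = D := by simp only [hr, sum_sub_distrib, hp', hD]
  have htD : ∑ j, t j = D := by
    simp only [ht, sum_sub_distrib, hq', hD]; rw [sum_comm]
  have hD0 : 0 ≤ D := hrD ▸ sum_nonneg fun i _ => hr0 i
  have hDle : D ≤ ∑ i, |p i - p' i| + ∑ j, |q j - q' j| := by
    have e1 : ∑ i, ∑ j, w i j = 1 := by simp only [hwp, hp]
    have e2 : ∑ i, p i * (1 - a i) = ∑ i, ∑ j, w i j * (1 - a i) :=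
      sum_congr rfl fun i _ => by rw [← hwp i, sum_mul]
    have e3 : ∑ j, q j * (1 - b j) = ∑ i, ∑ j, w i j * (1 - b j) := by
      rw [sum_comm]; exact sum_congr rfl fun j _ => by rw [← hwq j, sum_mul]
    calc D = ∑ i, ∑ j, (w i j - w i j * a i * b j) := by
          simp only [sum_sub_distrib, e1, hD]
      -- This is `1 - ab ≤ (1 - a) + (1 - b)` for `a, b ≤ 1`.
      _ ≤ ∑ i, ∑ j, (w i j * (1 - a i) + w i j * (1 - b j)) := by
          refine sum_le_sum fun i _ => sum_le_sum fun j _ => ?_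
          have := mul_nonneg (hw i j)
            (mul_nonneg (sub_nonneg.2 (hA i).2.1) (sub_nonneg.2 (hB j).2.1))
          change 0 ≤ w i j * ((1 - a i) * (1 - b j)) at this
          nlinarith
      _ = ∑ i, p i * (1 - a i) + ∑ j, q j * (1 - b j) := by
          rw [e2, e3]; simp only [sum_add_distrib]
      _ ≤ _ := add_le_add (sum_le_sum fun i _ => (hA i).2.2.2)
          (sum_le_sum fun j _ => (hB j).2.2.2)
  -- The missing mass is filled in by the product of the deficits. If `D = 0`, all deficits vanish
  -- and the quotient is `0` by convention.
  refine ⟨fun i j => w i j * a i * b j + r i * t j / D, fun i j =>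
    add_nonneg (h0 i j) (div_nonneg (mul_nonneg (hr0 i) (ht0 j)) hD0), ?_, ?_, ?_⟩
  · intro i
    rw [sum_add_distrib, ← sum_div, ← mul_sum, htD]
    rcases hD0.eq_or_lt with h | h
    · have : r i = 0 := (sum_eq_zero_iff_of_nonneg fun i _ => hr0 i).1 (hrD.trans h.symm) i
        (mem_univ i)
      simp only [this, zero_mul, zero_div, add_zero]
      exact (sub_eq_zero.1 this).symm
    · rw [mul_div_cancel_right₀ _ h.ne']; simp [hr]
  · intro j
    have e : ∑ i, r i * t j / D = D * t j / D := by rw [← sum_div, ← sum_mul, hrD]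
    rw [sum_add_distrib, e]
    rcases hD0.eq_or_lt with h | h
    · have : t j = 0 := (sum_eq_zero_iff_of_nonneg fun j _ => ht0 j).1 (htD.trans h.symm) j
        (mem_univ j)
      simp only [this, mul_zero, zero_div, add_zero]
      exact (sub_eq_zero.1 this).symm
    · rw [mul_div_cancel_left₀ _ h.ne']; simp [ht]
  · intro M s hs hsM
    have hne : Nonempty ι := by
      by_contra h
      rw [not_nonempty_iff] at h
      simp at hp
    have hne' : Nonempty κ := by
      by_contra h
      rw [not_nonempty_iff] at h
      simp at hq'
    have hM : 0 ≤ M := (hs hne.some hne'.some).trans (hsM _ _)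
    have e : ∑ i, ∑ j, M * (r i * t j / D) = M * D := by
      simp only [← mul_sum, ← sum_div]
      rw [htD, ← sum_mul, hrD, mul_self_div_self]
    calc _ ≤ ∑ i, ∑ j, (s i j * w i j + M * (r i * t j / D)) := by
          refine sum_le_sum fun i _ => sum_le_sum fun j _ => ?_
          rw [mul_add]
          refine add_le_add (mul_le_mul_of_nonneg_left ?_ (hs i j)) (mul_le_mul_of_nonneg_right
            (hsM i j) (div_nonneg (mul_nonneg (hr0 i) (ht0 j)) hD0))
          rw [mul_assoc]
          exact mul_le_of_le_one_right (hw i j)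
            (mul_le_one₀ (hA i).2.1 (hB j).1 (hB j).2.1)
      _ = ∑ i, ∑ j, s i j * w i j + M * D := by rw [← e]; simp only [sum_add_distrib]
      _ ≤ _ := by gcongr

theorem ae_measure_fiber_ne_zero {X ι : Type*} [MeasurableSpace X] [Fintype ι] (μ : Measure X)
    (k : X → ι) : ∀ᵐ x ∂μ, μ (k ⁻¹' {k x}) ≠ 0 := by
  have h : μ (⋃ i ∈ {i | μ (k ⁻¹' {i}) = 0}, k ⁻¹' {i}) = 0 :=
    (measure_biUnion_null_iff (to_countable _)).2 fun i hi => hi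
  refine measure_mono_null (fun x hx => ?_) h
  simp only [mem_compl_iff, mem_ofPred_eq, not_not] at hx
  exact mem_biUnion (show k x ∈ {i | μ (k ⁻¹' {i}) = 0} from hx) rfl

theorem lintegral_comp_fiber {X ι : Type*} [MeasurableSpace X] [Fintype ι] [MeasurableSpace ι]
    [MeasurableSingletonClass ι] (μ : Measure X) {k : X → ι} (hk : Measurable k)
    (f : ι → ℝ≥0∞) : ∫⁻ x, f (k x) ∂μ = ∑ i, f i * μ (k ⁻¹' {i}) := by
  rw [← lintegral_map (measurable_of_finite f) hk, lintegral_fintype]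
  exact Finset.sum_congr rfl fun i _ => by
    rw [Measure.map_apply hk (measurableSet_singleton i)]

/-- A coupling matrix of the masses of the cells of a finite partition is induced by a coupling. -/
theorem exists_coupling_of_matrix {X ι : Type*} [MeasurableSpace X] [Fintype ι]
    [MeasurableSpace ι] [MeasurableSingletonClass ι] (μ ν : Measure X) [IsProbabilityMeasure μ]
    [IsProbabilityMeasure ν] {k : X → ι} (hk : Measurable k) (w : ι → ι → ℝ)
    (hw : ∀ i j, 0 ≤ w i j) (hμ : ∀ i, ∑ j, w i j = μ.real (k ⁻¹' {i}))
    (hν : ∀ j, ∑ i, w i j = ν.real (k ⁻¹' {j})) :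
    ∃ π : Measure (X × X), π.fst = μ ∧ π.snd = ν ∧ ∀ f : ι → ι → ℝ≥0∞,
      ∫⁻ z, f (k z.1) (k z.2) ∂π = ∑ i, ∑ j, f i j * ENNReal.ofReal (w i j) := by
  set P : ι → ℝ≥0∞ := fun i => μ (k ⁻¹' {i}) with hP
  set Q : ι → ℝ≥0∞ := fun j => ν (k ⁻¹' {j}) with hQ
  have hPt : ∀ i, P i ≠ ⊤ := fun i => measure_ne_top _ _
  have hQt : ∀ i, Q i ≠ ⊤ := fun i => measure_ne_top _ _
  -- The coupling is the product measure reweighted on each pair of cells to have mass `w i j`. On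
  -- pairs of zero product mass `w i j` vanishes, so the density is `0 / 0 = 0`.
  set d : ι → ι → ℝ≥0∞ := fun i j => ENNReal.ofReal (w i j) / (P i * Q j) with hd
  have hrow : ∀ i, ∑ j, ENNReal.ofReal (w i j) = P i := fun i => by
    rw [← ENNReal.ofReal_sum_of_nonneg fun j _ => hw i j, hμ, ofReal_measureReal]
  have hcol : ∀ j, ∑ i, ENNReal.ofReal (w i j) = Q j := fun i => by
    rw [← ENNReal.ofReal_sum_of_nonneg fun j _ => hw j i, hν, ofReal_measureReal]
  have hwP : ∀ i j, P i = 0 → ENNReal.ofReal (w i j) = 0 := fun i j h =>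
    Finset.sum_eq_zero_iff.1 ((hrow i).trans h) j (Finset.mem_univ j)
  have hwQ : ∀ i j, Q j = 0 → ENNReal.ofReal (w i j) = 0 := fun i j h =>
    Finset.sum_eq_zero_iff.1 ((hcol j).trans h) i (Finset.mem_univ i)
  have hdQ : ∀ i j, d i j * Q j = ENNReal.ofReal (w i j) / P i := fun i j => by
    by_cases h : Q j = 0
    · simp [hwQ i j h, h]
    · simp only [hd]
      rw [div_eq_mul_inv, div_eq_mul_inv,
        ENNReal.mul_inv (Or.inr (hQt j)) (Or.inr h), mul_assoc, mul_assoc,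
        ENNReal.inv_mul_cancel h (hQt j), mul_one]
  have hdP : ∀ i j, d i j * P i = ENNReal.ofReal (w i j) / Q j := fun i j => by
    by_cases h : P i = 0
    · simp [hwP i j h, h]
    · simp only [hd]
      rw [div_eq_mul_inv, div_eq_mul_inv, mul_comm (P i),
        ENNReal.mul_inv (Or.inr (hPt i)) (Or.inr h), mul_assoc, mul_assoc,
        ENNReal.inv_mul_cancel h (hPt i), mul_one]
  have hm : ∀ f : ι → ι → ℝ≥0∞, Measurable fun z : X × X => f (k z.1) (k z.2) := fun f =>
    (measurable_of_finite (fun p : ι × ι => f p.1 p.2)).comp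
      ((hk.comp measurable_fst).prodMk (hk.comp measurable_snd))
  refine ⟨(μ.prod ν).withDensity fun z => d (k z.1) (k z.2), ?_, ?_, ?_⟩
  · ext B hB
    rw [Measure.fst_apply hB, withDensity_apply _ (measurable_fst hB), ← prod_univ,
      ← Measure.prod_restrict, Measure.restrict_univ, lintegral_prod _ (hm d).aemeasurable]
    simp only [lintegral_comp_fiber ν hk]
    rw [← setLIntegral_one]
    refine lintegral_congr_ae ((ae_restrict_of_ae (ae_measure_fiber_ne_zero μ k)).mono
      fun x hx => ?_)
    change ∑ j, d (k x) j * Q j = 1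
    simp only [hdQ, div_eq_mul_inv]
    rw [← Finset.sum_mul, hrow, ENNReal.mul_inv_cancel hx (hPt _)]
  · ext B hB
    rw [Measure.snd_apply hB, withDensity_apply _ (measurable_snd hB), ← univ_prod,
      ← Measure.prod_restrict, Measure.restrict_univ, lintegral_prod_symm _ (hm d).aemeasurable]
    have e : ∀ y, ∫⁻ x, d (k x) (k y) ∂μ = _ := fun y =>
      lintegral_comp_fiber μ hk fun i => d i (k y)
    simp only [e]
    rw [← setLIntegral_one]
    refine lintegral_congr_ae ((ae_restrict_of_ae (ae_measure_fiber_ne_zero ν k)).mono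
      fun y hy => ?_)
    change ∑ i, d i (k y) * P i = 1
    simp only [hdP, div_eq_mul_inv]
    rw [← Finset.sum_mul, hcol, ENNReal.mul_inv_cancel hy (hQt _)]
  · intro f
    rw [lintegral_withDensity_eq_lintegral_mul _ (hm d) (hm f)]
    have := hm fun i j => d i j * f i j
    simp only [Pi.mul_apply]
    rw [lintegral_prod _ this.aemeasurable]
    have e : ∀ x, ∫⁻ y, d (k x) (k y) * f (k x) (k y) ∂ν = _ := fun x =>
      lintegral_comp_fiber ν hk fun j => d (k x) j * f (k x) j
    simp only [e]
    rw [lintegral_comp_fiber μ hk fun i => ∑ j, d i j * f i j * ν (k ⁻¹' {j})]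
    refine Finset.sum_congr rfl fun i _ => ?_
    rw [Finset.sum_mul]
    refine Finset.sum_congr rfl fun j _ => ?_
    calc d i j * f i j * Q j * P i = f i j * (d i j * Q j * P i) := by ring
      _ = f i j * ENNReal.ofReal (w i j) := by
        rw [hdQ]
        by_cases h : P i = 0
        · simp [hwP i j h]
        · rw [ENNReal.div_mul_cancel h (hPt i)]

theorem ae_mem_prod_of_coupling {X : Type*} [MeasurableSpace X] {π : Measure (X × X)}
    {N : Set X} (h₁ : ∀ᵐ x ∂π.fst, x ∈ N) (h₂ : ∀ᵐ x ∂π.snd, x ∈ N) :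
    ∀ᵐ z ∂π, z.1 ∈ N ∧ z.2 ∈ N :=
  (ae_of_ae_map measurable_fst.aemeasurable h₁).and
    (ae_of_ae_map measurable_snd.aemeasurable h₂)

/-- Comparison of two optimal transport problems whose costs differ by at most `δ` on the cells
of a finite partition. -/
theorem OT_le_of_cells {ι : Type*} [Fintype ι] [MeasurableSpace ι] [MeasurableSingletonClass ι]
    (μ ν μ' ν' : Measure E3) [IsProbabilityMeasure μ] [IsProbabilityMeasure ν]
    [IsProbabilityMeasure μ'] [IsProbabilityMeasure ν'] {k : E3 → ι} (hk : Measurable k)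
    {N N' : Set E3} (hμ : ∀ᵐ x ∂μ, x ∈ N) (hν : ∀ᵐ x ∂ν, x ∈ N) (hμ' : ∀ᵐ x ∂μ', x ∈ N')
    (hν' : ∀ᵐ x ∂ν', x ∈ N') (c c' : E3 → E3 → ℝ≥0∞) (δ : ℝ≥0∞) (M : ℝ)
    (hM : ∀ x ∈ N', ∀ y ∈ N', c' x y ≤ ENNReal.ofReal M)
    (h : ∀ x ∈ N, ∀ y ∈ N, ∀ x' ∈ N', ∀ y' ∈ N', k x = k x' → k y = k y' → c' x' y' ≤ c x y + δ) :
    OT μ' ν' c' ≤ OT μ ν c + (δ + ENNReal.ofReal (M *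
      (∑ i, |μ.real (k ⁻¹' {i}) - μ'.real (k ⁻¹' {i})| +
        ∑ j, |ν.real (k ⁻¹' {j}) - ν'.real (k ⁻¹' {j})|))) := by
  -- With the error moved to the left, the bound can be checked for each coupling `π` separately.
  rw [← tsub_le_iff_right]
  refine le_iInf₂ fun π hπ => tsub_le_iff_right.2 ?_
  obtain ⟨hπ₁, hπ₂⟩ := hπ
  have : IsProbabilityMeasure π := ⟨by
    rw [← Measure.fst_univ, hπ₁]; exact measure_univ⟩
  have hk2 : Measurable (Prod.map k k) := hk.prodMap hk
  set w : ι → ι → ℝ := fun i j => π.real ((k ⁻¹' {i}) ×ˢ (k ⁻¹' {j})) with hw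
  have hsing : ∀ i, MeasurableSet (k ⁻¹' {i}) := fun i => hk (measurableSet_singleton i)
  have hsum1 : ∀ μ : Measure E3, IsProbabilityMeasure μ → ∑ i, μ.real (k ⁻¹' {i}) = 1 := by
    intro μ _
    have := lintegral_comp_fiber μ hk 1
    simp only [Pi.one_apply, lintegral_const, measure_univ, one_mul] at this
    simp only [measureReal_def]
    rw [← ENNReal.toReal_sum fun i _ => measure_ne_top _ _, ← this, ENNReal.toReal_one]
  have hrow : ∀ i, ∑ j, w i j = μ.real (k ⁻¹' {i}) := fun i => by
    have e : (k ⁻¹' {i}) ×ˢ univ = ⋃ j ∈ (Finset.univ : Finset ι), (k ⁻¹' {i}) ×ˢ (k ⁻¹' {j}) := by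
      ext z; simp
    rw [← hπ₁, measureReal_def, Measure.fst_apply (hsing i), ← prod_univ, e, ← measureReal_def,
      measureReal_biUnion_finset _ fun j _ => (hsing i).prod (hsing j)]
    intro j _ j' _ hjj
    exact disjoint_left.2 fun z hz hz' => hjj (hz.2.symm.trans hz'.2)
  have hcol : ∀ j, ∑ i, w i j = ν.real (k ⁻¹' {j}) := fun j => by
    have e : univ ×ˢ (k ⁻¹' {j}) = ⋃ i ∈ (Finset.univ : Finset ι), (k ⁻¹' {i}) ×ˢ (k ⁻¹' {j}) := by
      ext z; simp
    rw [← hπ₂, measureReal_def, Measure.snd_apply (hsing j), ← univ_prod, e, ← measureReal_def,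
      measureReal_biUnion_finset _ fun i _ => (hsing i).prod (hsing j)]
    intro j _ j' _ hjj
    exact disjoint_left.2 fun z hz hz' => hjj (hz.1.symm.trans hz'.1)
  obtain ⟨w', hw'0, hw'r, hw'c, hw'⟩ := exists_coupling_matrix w (fun i => μ.real (k ⁻¹' {i}))
    (fun i => ν.real (k ⁻¹' {i})) (fun i => μ'.real (k ⁻¹' {i})) (fun i => ν'.real (k ⁻¹' {i}))
    (fun i j => measureReal_nonneg) hrow hcol (hsum1 μ inferInstance)
    (fun i => measureReal_nonneg) (fun i => measureReal_nonneg) (hsum1 μ' inferInstance)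
    (hsum1 ν' inferInstance)
  obtain ⟨π', h1, h2, h3⟩ := exists_coupling_of_matrix μ' ν' hk w' hw'0 hw'r hw'c
  -- `S ∘ (k × k)` dominates `c'` and takes finitely many values, so it can be integrated exactly
  -- although `c'` need not be measurable.
  set S : ι → ι → ℝ≥0∞ := fun i j =>
    ⨆ (x ∈ N') (y ∈ N') (_ : k x = i) (_ : k y = j), c' x y with hS
  have hSM : ∀ i j, S i j ≤ ENNReal.ofReal M := fun i j =>
    iSup₂_le fun x hx => iSup₂_le fun y hy => iSup₂_le fun _ _ => hM x hx y hy
  have hSt : ∀ i j, S i j ≠ ⊤ := fun i j => ((hSM i j).trans_lt ENNReal.ofReal_lt_top).ne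
  have conv : ∀ v : ι → ι → ℝ, (∀ i j, 0 ≤ v i j) →
      ∑ i, ∑ j, S i j * ENNReal.ofReal (v i j) =
        ENNReal.ofReal (∑ i, ∑ j, (S i j).toReal * v i j) := fun v hv => by
    have h0 : ∀ i j, 0 ≤ (S i j).toReal * v i j := fun i j =>
      mul_nonneg ENNReal.toReal_nonneg (hv i j)
    rw [ENNReal.ofReal_sum_of_nonneg fun i _ => Finset.sum_nonneg fun j _ => h0 i j]
    refine Finset.sum_congr rfl fun i _ => ?_
    rw [ENNReal.ofReal_sum_of_nonneg fun j _ => h0 i j]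
    refine Finset.sum_congr rfl fun j _ => ?_
    rw [ENNReal.ofReal_mul ENNReal.toReal_nonneg, ENNReal.ofReal_toReal (hSt i j)]
  have hπS : ∑ i, ∑ j, S i j * ENNReal.ofReal (w i j) = ∫⁻ z, S (k z.1) (k z.2) ∂π := by
    have := lintegral_comp_fiber π hk2 fun p => S p.1 p.2
    simp only [Prod.map_fst, Prod.map_snd] at this
    rw [this, Fintype.sum_prod_type]
    refine Finset.sum_congr rfl fun i _ => Finset.sum_congr rfl fun j _ => ?_
    rw [hw, ofReal_measureReal]
    congr 2
    ext z; simp [Prod.ext_iff]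
  have hM0 : ∀ i j, (S i j).toReal ≤ max M 0 := fun i j => by
    rw [← ENNReal.toReal_ofReal']
    exact ENNReal.toReal_mono ENNReal.ofReal_ne_top (hSM i j)
  calc OT μ' ν' c' ≤ ∫⁻ z, c' z.1 z.2 ∂π' := iInf₂_le π' ⟨h1, h2⟩
    _ ≤ ∫⁻ z, S (k z.1) (k z.2) ∂π' := by
        refine lintegral_mono_ae ((ae_mem_prod_of_coupling (h1 ▸ hμ') (h2 ▸ hν')).mono
          fun z hz => ?_)
        exact le_iSup₂_of_le z.1 hz.1 (le_iSup₂_of_le z.2 hz.2 (le_iSup₂_of_le rfl rfl le_rfl))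
    _ = ENNReal.ofReal (∑ i, ∑ j, (S i j).toReal * w' i j) := by rw [h3, conv _ hw'0]
    _ ≤ ENNReal.ofReal (∑ i, ∑ j, (S i j).toReal * w i j + max M 0 *
      (∑ i, |μ.real (k ⁻¹' {i}) - μ'.real (k ⁻¹' {i})| +
        ∑ j, |ν.real (k ⁻¹' {j}) - ν'.real (k ⁻¹' {j})|)) :=
        ENNReal.ofReal_le_ofReal (hw' _ _ (fun i j => ENNReal.toReal_nonneg) hM0)
    _ ≤ ENNReal.ofReal (∑ i, ∑ j, (S i j).toReal * w i j) + ENNReal.ofReal (max M 0 *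
      (∑ i, |μ.real (k ⁻¹' {i}) - μ'.real (k ⁻¹' {i})| +
        ∑ j, |ν.real (k ⁻¹' {j}) - ν'.real (k ⁻¹' {j})|)) := ENNReal.ofReal_add_le
    _ = ∫⁻ z, S (k z.1) (k z.2) ∂π + ENNReal.ofReal (M *
      (∑ i, |μ.real (k ⁻¹' {i}) - μ'.real (k ⁻¹' {i})| +
        ∑ j, |ν.real (k ⁻¹' {j}) - ν'.real (k ⁻¹' {j})|)) := by
        rw [← conv w fun i j => measureReal_nonneg, hπS]
        congr 1
        have h0 : 0 ≤ ∑ i, |μ.real (k ⁻¹' {i}) - μ'.real (k ⁻¹' {i})| +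
          ∑ j, |ν.real (k ⁻¹' {j}) - ν'.real (k ⁻¹' {j})| := by positivity
        rw [ENNReal.ofReal_mul' h0, ENNReal.ofReal_mul' h0, ENNReal.ofReal_max]
        simp
    _ ≤ (∫⁻ z, c z.1 z.2 ∂π + δ) + ENNReal.ofReal (M *
      (∑ i, |μ.real (k ⁻¹' {i}) - μ'.real (k ⁻¹' {i})| +
        ∑ j, |ν.real (k ⁻¹' {j}) - ν'.real (k ⁻¹' {j})|)) := by
        gcongr
        calc ∫⁻ z, S (k z.1) (k z.2) ∂π ≤ ∫⁻ z, (c z.1 z.2 + δ) ∂π := by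
              refine lintegral_mono_ae ((ae_mem_prod_of_coupling (hπ₁ ▸ hμ) (hπ₂ ▸ hν)).mono
                fun z hz => ?_)
              exact iSup₂_le fun x hx => iSup₂_le fun y hy => iSup₂_le fun hkx hky =>
                h _ hz.1 _ hz.2 x hx y hy hkx.symm hky.symm
          _ = ∫⁻ z, c z.1 z.2 ∂π + δ := by
              -- The sum splits because the constant summand is measurable; nothing is needed of
              -- `c`.
              rw [lintegral_add_right _ measurable_const]; simp
    _ = _ := add_assoc _ _ _

/-! ### Small cells with null boundary -/

/-- A finite family of balls with null boundaries separates the points of a compact set up to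
distance `r`; the cells of the induced partition have null boundaries. -/
theorem exists_cells {X : Type*} [PseudoMetricSpace X] [MeasurableSpace X]
    [OpensMeasurableSpace X] (μ : Measure X) [IsFiniteMeasure μ] {K : Set X} (hK : IsCompact K)
    {r : ℝ} (hr : 0 < r) :
    ∃ (t : Finset X) (k : X → t → Prop), Measurable k ∧ (∀ σ, μ (frontier (k ⁻¹' {σ})) = 0) ∧
      ∀ x ∈ K, ∀ y, k x = k y → dist x y < r := by
  have hρ : ∀ x : X, ∃ ρ ∈ Ioo 0 (r / 2), μ (frontier (Metric.ball x ρ)) = 0 := fun x => by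
    simpa only [Metric.thickening_singleton] using
      exists_null_frontier_thickening μ {x} (half_pos hr)
  choose ρ hρ hρ0 using hρ
  obtain ⟨t, -, ht⟩ := hK.elim_nhds_subcover (fun x => Metric.ball x (ρ x))
    fun x _ => Metric.ball_mem_nhds x (hρ x).1
  -- A cell is the set of points lying in exactly the same balls of the finite cover.
  refine ⟨t, fun x m => x ∈ Metric.ball m.1 (ρ m), ?_, ?_, ?_⟩
  · exact measurable_pi_lambda _ fun m => measurableSet_setOfPred.1 Metric.isOpen_ball.measurableSet
  · intro σ
    refine measure_mono_null (t := ⋃ m : t, frontier (Metric.ball m.1 (ρ m))) ?_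
      ((measure_iUnion_null_iff).2 fun m => hρ0 m)
    intro x hx
    by_contra hx'
    simp only [mem_iUnion, not_exists] at hx'
    -- Off the boundaries of all balls the membership pattern is locally constant, so such a point
    -- is not a boundary point of a cell.
    have hloc : ∀ᶠ y in 𝓝 x, ∀ m : t,
        (y ∈ Metric.ball m.1 (ρ m) ↔ x ∈ Metric.ball m.1 (ρ m)) := by
      refine eventually_all.2 fun m => ?_
      by_cases h : x ∈ Metric.ball m.1 (ρ m)
      · filter_upwards [Metric.isOpen_ball.mem_nhds h] with y hy
        exact iff_of_true hy h
      · have h2 : x ∉ closure (Metric.ball m.1 (ρ m)) := fun hc =>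
          hx' m ⟨hc, fun hi => h (interior_subset hi)⟩
        filter_upwards [isClosed_closure.isOpen_compl.mem_nhds h2] with y hy
        exact iff_of_false (fun hy' => hy (subset_closure hy')) h
    rw [frontier, Set.mem_sdiff, mem_closure_iff_frequently, mem_interior_iff_mem_nhds] at hx
    obtain ⟨y, hy, hy'⟩ := (hx.1.and_eventually hloc).exists
    refine hx.2 ?_
    filter_upwards [hloc] with z hz
    have hyσ : (fun m : t => y ∈ Metric.ball m.1 (ρ m)) = σ := hy
    change (fun m : t => z ∈ Metric.ball m.1 (ρ m)) = σ
    rw [← hyσ]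
    exact funext fun m => propext ((hz m).trans (hy' m).symm)
  · intro x hx y hxy
    obtain ⟨m, hm, hxm⟩ := mem_iUnion₂.1 (ht hx)
    have hym : y ∈ Metric.ball m (ρ m) := by
      have := congrFun hxy ⟨m, hm⟩
      exact this.mp hxm
    calc dist x y ≤ dist x m + dist y m := dist_triangle_right _ _ _
      _ < r / 2 + r / 2 := add_lt_add (hxm.trans (hρ m).2) (hym.trans (hρ m).2)
      _ = r := add_halves r

/-! ### Piecewise `C¹` curves -/

/-- Piecewise continuously differentiable on `[a, b]`. -/
def PiecewiseC1On (a b : ℝ) (γ : ℝ → E3) : Prop :=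
  ∃ (n : ℕ) (t : ℕ → ℝ), t 0 = a ∧ t n = b ∧
    ∀ i < n, t i < t (i + 1) ∧ ContDiffOn ℝ 1 γ (Icc (t i) (t (i + 1)))

theorem le_of_partition {n : ℕ} {t : ℕ → ℝ} (h : ∀ i < n, t i < t (i + 1)) {i j : ℕ}
    (hij : i ≤ j) (hj : j ≤ n) : t i ≤ t j := by
  induction j, hij using Nat.le_induction with
  | base => exact le_rfl
  | succ j hij ih => exact (ih (by omega)).trans (h j (by omega)).le

namespace PiecewiseC1On

variable {a b c : ℝ} {γ γ' : ℝ → E3}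

theorem of_contDiffOn (hab : a < b) (h : ContDiffOn ℝ 1 γ (Icc a b)) : PiecewiseC1On a b γ :=
  ⟨1, fun i => if i = 0 then a else b, by simp, by simp, fun i hi => by
    obtain rfl : i = 0 := by omega
    simpa using ⟨hab, h⟩⟩

theorem trans (h : PiecewiseC1On a b γ) (h' : PiecewiseC1On b c γ) : PiecewiseC1On a c γ := by
  obtain ⟨n, t, rfl, rfl, ht⟩ := h
  obtain ⟨m, s, hs0, rfl, hs⟩ := h'
  refine ⟨n + m, fun i => if i ≤ n then t i else s (i - n), by simp, ?_, fun i hi => ?_⟩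
  · rcases Nat.eq_zero_or_pos m with rfl | hm
    · simp [hs0]
    · simp [hm.ne']
  · rcases lt_trichotomy i n with h | rfl | h
    · simpa [h.le, Nat.succ_le_of_lt h] using ht i h
    · simpa [hs0] using hs 0 (by omega)
    · have h1 : ¬ i ≤ n := by omega
      have h2 : ¬ i + 1 ≤ n := by omega
      have h3 : i + 1 - n = i - n + 1 := by omega
      simpa [h1, h2, h3] using hs (i - n) (by omega)

theorem mono_pieces (h : PiecewiseC1On a b γ)
    (hγ : ∀ s ⊆ Icc a b, ContDiffOn ℝ 1 γ s → ContDiffOn ℝ 1 γ' s) : PiecewiseC1On a b γ' := by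
  obtain ⟨n, t, rfl, rfl, ht⟩ := h
  refine ⟨n, t, rfl, rfl, fun i hi => ⟨(ht i hi).1, hγ _ (Icc_subset_Icc ?_ ?_) (ht i hi).2⟩⟩
  · exact le_of_partition (fun i hi => (ht i hi).1) (Nat.zero_le _) hi.le
  · exact le_of_partition (fun i hi => (ht i hi).1) hi le_rfl

theorem congr (h : PiecewiseC1On a b γ) (hγ : EqOn γ' γ (Icc a b)) : PiecewiseC1On a b γ' :=
  h.mono_pieces fun _ hs hc => hc.congr fun _ hx => hγ (hs hx)

theorem comp_contDiffOn (h : PiecewiseC1On a b γ) {Ψ : E3 → E3} {W : Set E3}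
    (hΨ : ContDiffOn ℝ 1 Ψ W) (hγ : MapsTo γ (Icc a b) W) : PiecewiseC1On a b (Ψ ∘ γ) :=
  h.mono_pieces fun _ hs hc => hΨ.comp hc (hγ.mono_left hs)

theorem comp_affine (h : PiecewiseC1On a b γ) {m : ℝ} (hm : 0 < m) (d : ℝ) :
    PiecewiseC1On (a * m + d) (b * m + d) (fun s => γ ((s - d) / m)) := by
  obtain ⟨n, t, rfl, rfl, ht⟩ := h
  refine ⟨n, fun i => t i * m + d, rfl, rfl, fun i hi => ⟨?_, ?_⟩⟩
  · have := mul_lt_mul_of_pos_right (ht i hi).1 hm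
    simpa using this
  · refine (ht i hi).2.comp (by fun_prop) fun s hs => ?_
    simp only [mem_Icc] at hs
    exact ⟨by rw [le_div_iff₀ hm]; linarith [hs.1], by rw [div_le_iff₀ hm]; linarith [hs.2]⟩

/-- Differentiability can fail only at the finitely many partition points, which form a null set. -/
theorem ae_differentiableAt (h : PiecewiseC1On a b γ) :
    ∀ᵐ t ∂volume.restrict (Icc a b), DifferentiableAt ℝ γ t := by
  obtain ⟨n, t, rfl, rfl, ht⟩ := h
  induction n with
  | zero => simp
  | succ n ih =>
    have h1 := ih fun i hi => ht i (by omega)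
    have hle : t 0 ≤ t n := le_of_partition (fun i hi => (ht i hi).1) (Nat.zero_le _) (by omega)
    rw [← Icc_union_Icc_eq_Icc hle (ht n (by omega)).1.le, ae_restrict_union_iff]
    refine ⟨h1, ?_⟩
    rw [Measure.restrict_congr_set Ioo_ae_eq_Icc.symm]
    refine (ae_restrict_mem measurableSet_Ioo).mono fun s hs => ?_
    exact ((ht n (by omega)).2.differentiableOn (by simp)).differentiableAt
      (Icc_mem_nhds hs.1 hs.2)

end PiecewiseC1On

/-! ### Calculus of the action cost -/

/-- The infimum of the action with respect to `U` over all curves from `x` to `y`. -/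
noncomputable def costOn (U : Set E3) (x y : E3) : ℝ≥0∞ := ⨅ γ ∈ curves x y, action U γ

theorem penalty_anti {U U' : Set E3} (h : U ⊆ U') (x : E3) : penalty U' x ≤ penalty U x := by
  unfold penalty
  by_cases hx : x ∈ U
  · simp [hx, h hx]
  · simp [hx]

theorem costOn_anti {U U' : Set E3} (h : U ⊆ U') (x y : E3) : costOn U' x y ≤ costOn U x y :=
  iInf₂_mono fun _ _ => lintegral_mono fun _ => add_le_add le_rfl (penalty_anti h _)

theorem costOn_le_of_segment_subset {U : Set E3} {x y : E3} (h : segment ℝ x y ⊆ U) :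
    costOn U x y ≤ ‖y - x‖ₑ ^ 2 := by
  have hd : ∀ t, HasDerivAt (fun t : ℝ => AffineMap.lineMap x y t) (y - x) t := fun t =>
    AffineMap.hasDerivAt_lineMap
  have hc : ContDiff ℝ 1 (fun t : ℝ => (AffineMap.lineMap x y t : E3)) := by
    simp only [AffineMap.lineMap_apply_module']
    fun_prop
  refine (iInf₂_le (fun t : ℝ => AffineMap.lineMap x y t) ⟨⟨hc.continuous.continuousOn,
    PiecewiseC1On.of_contDiffOn zero_lt_one hc.contDiffOn⟩, by simp, by simp⟩).trans ?_
  calc action U (fun t : ℝ => AffineMap.lineMap x y t)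
      = ∫⁻ t in Icc (0 : ℝ) 1, ‖y - x‖ₑ ^ 2 := by
        refine setLIntegral_congr_fun measurableSet_Icc fun t ht => ?_
        have : (AffineMap.lineMap x y t : E3) ∈ U := h (by
          rw [segment_eq_image_lineMap]; exact mem_image_of_mem _ ht)
        simp only [(hd t).deriv, penalty, this, if_true, add_zero]
    _ ≤ _ := by simp

/-- Running a curve in time `m` multiplies the squared speed by `m⁻²` and the length of time by `m`,
hence the kinetic part by `m⁻¹`. The penalty part is multiplied by `m ≤ m⁻¹`. Agreement on the open
interval suffices, since the end points are null. -/
theorem lintegral_rescaled_le (U : Set E3) {m : ℝ} (hm : 0 < m) (hm1 : m ≤ 1) (d : ℝ)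
    {γ γ' : ℝ → E3} (h : ∀ s ∈ Ioo d (m + d), γ' s = γ ((s - d) / m)) :
    ∫⁻ t in Icc d (m + d), (‖deriv γ' t‖ₑ ^ 2 + penalty U (γ' t)) ≤
      ENNReal.ofReal m⁻¹ * action U γ := by
  have himg : (fun s : ℝ => m * s + d) '' Icc 0 1 = Icc d (m + d) := by
    rw [image_affine_Icc' hm]; simp
  rw [← himg, lintegral_image_eq_lintegral_abs_deriv_mul (f' := fun _ => m) measurableSet_Icc
    (fun s _ => by
      simpa using (((hasDerivAt_id s).const_mul m).add_const d).hasDerivWithinAt)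
    (fun s _ s' _ hs => by
      have : m * s + d = m * s' + d := hs
      exact mul_left_cancel₀ hm.ne' (by linarith)), action,
    ← lintegral_const_mul' _ _ ENNReal.ofReal_ne_top,
    Measure.restrict_congr_set Ioo_ae_eq_Icc.symm]
  refine setLIntegral_mono_ae' measurableSet_Ioo (Eventually.of_forall fun s hs => ?_)
  have hs' : m * s + d ∈ Ioo d (m + d) := by
    constructor
    · linarith [mul_pos hm hs.1]
    · linarith [mul_lt_mul_of_pos_left hs.2 hm]
  have e1 : (m * s + d - d) / m = s := by field_simp; ring
  have e2 : deriv γ' (m * s + d) = m⁻¹ • deriv γ s := by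
    have : γ' =ᶠ[𝓝 (m * s + d)] fun u => γ ((u - d) / m) := by
      filter_upwards [isOpen_Ioo.mem_nhds hs'] with u hu using h u hu
    rw [this.deriv_eq]
    have e3 : (fun u => γ ((u - d) / m)) = fun u => (fun v => γ (m⁻¹ * v)) (u - d) := by
      funext u; rw [div_eq_inv_mul]
    rw [e3, deriv_comp_sub_const (f := fun v => γ (m⁻¹ * v)), deriv_comp_mul_left]
    congr 2
    field_simp; ring
  have hmm : ENNReal.ofReal m * ENNReal.ofReal m⁻¹ = 1 := by
    rw [← ENNReal.ofReal_mul hm.le, mul_inv_cancel₀ hm.ne', ENNReal.ofReal_one]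
  have e4 : ‖m⁻¹‖ₑ = ENNReal.ofReal m⁻¹ := Real.enorm_of_nonneg (inv_pos.2 hm).le
  have h1 : ENNReal.ofReal m ≤ ENNReal.ofReal m⁻¹ :=
    ENNReal.ofReal_le_ofReal (hm1.trans ((one_le_inv₀ hm).2 hm1))
  rw [abs_of_pos hm, h _ hs', e1, e2, enorm_smul, e4, mul_add, mul_add]
  refine add_le_add (le_of_eq ?_) (mul_le_mul_left h1 _)
  calc ENNReal.ofReal m * (ENNReal.ofReal m⁻¹ * ‖deriv γ s‖ₑ) ^ 2
      = (ENNReal.ofReal m * ENNReal.ofReal m⁻¹) * (ENNReal.ofReal m⁻¹ * ‖deriv γ s‖ₑ ^ 2) := by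
        ring
    _ = _ := by rw [hmm, one_mul]

/-- Concatenation of curves, with the fraction `m` of the time spent on the first one. -/
theorem costOn_triangle (U : Set E3) (x y z : E3) {m : ℝ} (hm : 0 < m) (hm1 : m < 1) :
    costOn U x z ≤ ENNReal.ofReal m⁻¹ * costOn U x y + ENNReal.ofReal (1 - m)⁻¹ * costOn U y z := by
  have hm' : 0 < 1 - m := sub_pos.2 hm1
  have hne : ∀ {a : ℝ}, 0 < a → ENNReal.ofReal a⁻¹ ≠ 0 := fun ha => by simpa using ha
  simp only [costOn]
  rw [ENNReal.mul_iInf_of_ne (hne hm) ENNReal.ofReal_ne_top,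
    ENNReal.mul_iInf_of_ne (hne hm') ENNReal.ofReal_ne_top]
  simp only [ENNReal.mul_iInf_of_ne (hne hm) ENNReal.ofReal_ne_top,
    ENNReal.mul_iInf_of_ne (hne hm') ENNReal.ofReal_ne_top, ENNReal.iInf_add, ENNReal.add_iInf]
  refine le_iInf₂ fun γ₂ h₂ => le_iInf₂ fun γ₁ h₁ => ?_
  obtain ⟨⟨hc1, hp1⟩, h10, h11⟩ := h₁
  obtain ⟨⟨hc2, hp2⟩, h20, h21⟩ := h₂
  set γ : ℝ → E3 := fun s => if s ≤ m then γ₁ (s / m) else γ₂ ((s - m) / (1 - m)) with hγ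
  have E1 : EqOn γ (fun s => γ₁ ((s - 0) / m)) (Icc 0 m) := fun s hs => by
    simp [hγ, hs.2]
  have E2 : EqOn γ (fun s => γ₂ ((s - m) / (1 - m))) (Icc m 1) := fun s hs => by
    rcases hs.1.eq_or_lt with rfl | h
    · simp [hγ, div_self hm.ne', h11, h20]
    · simp [hγ, not_le.2 h]
  have C1 : ContinuousOn γ (Icc 0 m) := ContinuousOn.congr (hc1.comp (by fun_prop) fun s hs =>
    ⟨div_nonneg (by simpa using hs.1) hm.le, by rw [div_le_one hm]; simpa using hs.2⟩) E1
  have C2 : ContinuousOn γ (Icc m 1) := ContinuousOn.congr (hc2.comp (by fun_prop) fun s hs =>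
    ⟨div_nonneg (sub_nonneg.2 hs.1) hm'.le, by rw [div_le_one hm']; linarith [hs.2]⟩) E2
  have P1 : PiecewiseC1On 0 m γ := by
    have := PiecewiseC1On.comp_affine hp1 hm 0
    simp only [zero_mul, one_mul, add_zero] at this
    exact this.congr E1
  have P2 : PiecewiseC1On m 1 γ := by
    have := PiecewiseC1On.comp_affine hp2 hm' m
    simp only [zero_mul, one_mul, zero_add, sub_add_cancel] at this
    exact this.congr E2
  have hmem : γ ∈ curves x z := by
    refine ⟨⟨?_, P1.trans P2⟩, ?_, ?_⟩
    · rw [← Icc_union_Icc_eq_Icc hm.le hm1.le]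
      exact C1.union_of_isClosed C2 isClosed_Icc isClosed_Icc
    · rw [E1 (left_mem_Icc.2 hm.le)]; simpa using h10
    · rw [E2 (right_mem_Icc.2 hm1.le)]; simpa [div_self hm'.ne'] using h21
  refine (iInf₂_le γ hmem).trans ?_
  have I1 := lintegral_rescaled_le U hm hm1.le 0 (γ := γ₁) (γ' := γ)
    fun s hs => E1 ⟨hs.1.le, by simpa using hs.2.le⟩
  have I2 := lintegral_rescaled_le U hm' (by linarith) m (γ := γ₂) (γ' := γ)
    fun s hs => E2 ⟨hs.1.le, by simpa using hs.2.le⟩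
  rw [add_zero] at I1
  rw [sub_add_cancel] at I2
  rw [action, ← Icc_union_Icc_eq_Icc hm.le hm1.le]
  exact (lintegral_union_le _ _ _).trans (add_le_add I1 I2)

/-- Curves of finite action stay in the (closed) admissible set. -/
theorem mem_of_action_ne_top {U : Set E3} (hU : IsClosed U) {γ : ℝ → E3}
    (hγ : ContinuousOn γ (Icc 0 1)) (h : action U γ ≠ ⊤) : MapsTo γ (Icc 0 1) U := by
  -- Times in the open interval spent outside `U` form an open set; if nonempty, it has positive
  -- measure and infinite penalty. The end points follow by closedness of `U`.
  have hIoo : MapsTo γ (Ioo 0 1) U := by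
    by_contra hcon
    simp only [MapsTo, not_forall] at hcon
    obtain ⟨t, ht, htU⟩ := hcon
    have hopen : IsOpen (Ioo (0 : ℝ) 1 ∩ γ ⁻¹' Uᶜ) :=
      (hγ.mono Ioo_subset_Icc_self).isOpen_inter_preimage isOpen_Ioo hU.isOpen_compl
    have hpos := hopen.measure_pos volume ⟨t, ht, htU⟩
    apply h
    rw [eq_top_iff]
    calc (⊤ : ℝ≥0∞) = ∫⁻ t in Ioo (0 : ℝ) 1 ∩ γ ⁻¹' Uᶜ, ⊤ := by
          rw [setLIntegral_const, ENNReal.top_mul hpos.ne']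
      _ ≤ ∫⁻ t in Ioo (0 : ℝ) 1 ∩ γ ⁻¹' Uᶜ, (‖deriv γ t‖ₑ ^ 2 + penalty U (γ t)) := by
          refine setLIntegral_mono_ae' hopen.measurableSet (Eventually.of_forall fun s hs => ?_)
          have : γ s ∉ U := hs.2
          simp [penalty, this]
      _ ≤ _ := lintegral_mono_set (inter_subset_left.trans Ioo_subset_Icc_self)
  have hcl : closure (Ioo (0 : ℝ) 1) = Icc 0 1 := closure_Ioo zero_ne_one
  have := (hcl ▸ hγ : ContinuousOn γ (closure (Ioo 0 1))).image_closure
  rw [hcl] at this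
  exact mapsTo_iff_image_subset.2 (this.trans (closure_minimal hIoo.image_subset hU))

/-- The image of curves under a `C¹` map. -/
theorem costOn_map_le {U U' W : Set E3} (hU : IsClosed U) (hW : IsOpen W) (hUW : U ⊆ W)
    {Ψ : E3 → E3} (hΨ : ContDiffOn ℝ 1 Ψ W) (hΨU : MapsTo Ψ U U') {K : NNReal} (hK : 0 < K)
    (hb : ∀ x ∈ U, ‖fderiv ℝ Ψ x‖₊ ≤ K) (x y : E3) :
    costOn U' (Ψ x) (Ψ y) ≤ (K : ℝ≥0∞) ^ 2 * costOn U x y := by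
  have hK0 : (K : ℝ≥0∞) ^ 2 ≠ 0 := by simpa using hK.ne'
  have hKt : (K : ℝ≥0∞) ^ 2 ≠ ⊤ := by finiteness
  simp only [costOn, ENNReal.mul_iInf_of_ne hK0 hKt]
  refine le_iInf₂ fun γ hγ => ?_
  -- A curve of infinite action may leave `U`, where `Ψ` is not controlled; for it the bound is `K²
  -- * ⊤ = ⊤`, as `K ≠ 0`.
  by_cases htop : action U γ = ⊤
  · rw [htop, ENNReal.mul_top hK0]; exact le_top
  obtain ⟨⟨hc, hp⟩, h0, h1⟩ := hγ
  have hmaps := mem_of_action_ne_top hU hc htop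
  have hmem : Ψ ∘ γ ∈ curves (Ψ x) (Ψ y) :=
    ⟨⟨hΨ.continuousOn.comp hc (hmaps.mono_right hUW),
      PiecewiseC1On.comp_contDiffOn hp hΨ (hmaps.mono_right hUW)⟩, by simp [h0], by simp [h1]⟩
  refine (iInf₂_le (Ψ ∘ γ) hmem).trans ?_
  · rw [action, action, ← lintegral_const_mul' _ _ hKt]
    refine lintegral_mono_ae ?_
    filter_upwards [PiecewiseC1On.ae_differentiableAt hp, ae_restrict_mem measurableSet_Icc]
      with t hd ht
    have hU1 := hmaps ht
    have hΨd : DifferentiableAt ℝ Ψ (γ t) :=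
      (hΨ.differentiableOn (by simp)).differentiableAt (hW.mem_nhds (hUW hU1))
    have e : deriv (Ψ ∘ γ) t = fderiv ℝ Ψ (γ t) (deriv γ t) :=
      (hΨd.hasFDerivAt.comp_hasDerivAt t hd.hasDerivAt).deriv
    have hle : ‖deriv (Ψ ∘ γ) t‖ₑ ≤ K * ‖deriv γ t‖ₑ := by
      rw [e]
      simp only [enorm_eq_nnnorm]
      exact_mod_cast ((fderiv ℝ Ψ (γ t)).le_opNNNorm _).trans
        (mul_le_mul_left (hb _ hU1) _)
    have hp0 : penalty U' ((Ψ ∘ γ) t) = 0 := by simp [penalty, hΨU hU1]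
    have hp1 : penalty U (γ t) = 0 := by simp [penalty, hU1]
    rw [hp0, hp1, add_zero, add_zero, ← mul_pow]
    gcongr

/-! ### Collapsing maps onto a segment -/

/-- A `C¹` function that collapses neighbourhoods of the ends of `[0, ℓ]` to the ends, with
Lipschitz constant close to `1`. -/
theorem exists_collapse {ℓ : ℝ} (hℓ : 0 < ℓ) {η : NNReal} (hη : 0 < η) :
    ∃ R > 0, ∃ θ : ℝ → ℝ, ContDiff ℝ 1 θ ∧ LipschitzWith (1 + η) θ ∧
      (∀ s ≤ R, θ s = 0) ∧ (∀ s, ℓ - R ≤ s → θ s = ℓ) ∧ ∀ s, θ s ∈ Icc 0 ℓ := by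
  have hη' : (0 : ℝ) < η := hη
  -- This `R` gives `ℓ / (ℓ - 4R) ≤ 1 + η`. The normalised bump, supported in `[R, ℓ - R]` with
  -- plateau `[2R, ℓ - 2R]`, is at most `1 / (ℓ - 4R)`, and `θ` is `ℓ` times its primitive.
  set R : ℝ := η * ℓ / (8 * (1 + η)) with hR
  have hR0 : 0 < R := by positivity
  have hR1 : 8 * R * (1 + η) = η * ℓ := by rw [hR]; field_simp
  have hR2 : 8 * R < ℓ := by nlinarith
  let φ : ContDiffBump (ℓ / 2) :=
    { rIn := ℓ / 2 - 2 * R, rOut := ℓ / 2 - R, rIn_pos := by linarith, rIn_lt_rOut := by linarith }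
  set f : ℝ → ℝ := φ.normed volume with hf
  have hfc : Continuous f := φ.continuous_normed
  have hf0 : ∀ s, 0 ≤ f s := φ.nonneg_normed
  have hball : Metric.ball (ℓ / 2) φ.rOut = Ioo R (ℓ - R) := by
    rw [Real.ball_eq_Ioo]; congr 1 <;> simp only [φ] <;> ring
  have hsupp : Function.support f = Ioo R (ℓ - R) := by rw [hf, φ.support_normed_eq, hball]
  have hfle : ∀ s, ℓ * f s ≤ 1 + η := fun s => by
    have h1 := φ.normed_le_div_measure_closedBall_rIn volume s
    have h2 : volume.real (Metric.closedBall (ℓ / 2) φ.rIn) = ℓ - 4 * R := by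
      rw [Real.volume_real_closedBall φ.rIn_pos.le]; simp only [φ]; ring
    rw [h2] at h1
    calc ℓ * f s ≤ ℓ * (1 / (ℓ - 4 * R)) := by gcongr
      _ ≤ 1 + η := by
        rw [mul_one_div, div_le_iff₀ (by linarith)]
        nlinarith
  set θ : ℝ → ℝ := fun s => ℓ * ∫ u in (0 : ℝ)..s, f u with hθ
  have hd : ∀ s, HasDerivAt θ (ℓ * f s) s := fun s =>
    (hfc.integral_hasStrictDerivAt 0 s).hasDerivAt.const_mul ℓ
  have hderiv : deriv θ = fun s => ℓ * f s := funext fun s => (hd s).deriv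
  have hmono : Monotone θ := monotone_of_deriv_nonneg (fun s => (hd s).differentiableAt)
    fun s => by rw [hderiv]; exact mul_nonneg hℓ.le (hf0 s)
  have hlow : ∀ s ≤ R, θ s = 0 := fun s hs => by
    have : ∫ u in (0 : ℝ)..s, f u = ∫ u in (0 : ℝ)..s, (0 : ℝ) :=
      intervalIntegral.integral_congr fun u hu => by
        have hu' : u ≤ R := hu.2.trans (max_le hR0.le hs)
        exact Function.notMem_support.1 (by rw [hsupp]; exact fun h => absurd h.1 (not_lt.2 hu'))
    simp [hθ, this]
  have hhigh : ∀ s, ℓ - R ≤ s → θ s = ℓ := fun s hs => by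
    have : ∫ u in (0 : ℝ)..s, f u = ∫ u, f u :=
      intervalIntegral.integral_eq_integral_of_support_subset (by
        rw [hsupp]; exact fun u hu => ⟨hR0.trans hu.1, hu.2.le.trans hs⟩)
    simp only [hθ, this]
    rw [hf, φ.integral_normed, mul_one]
  refine ⟨R, hR0, θ, ?_, ?_, hlow, hhigh, fun s => ⟨?_, ?_⟩⟩
  · rw [contDiff_one_iff_deriv, hderiv]
    exact ⟨fun s => (hd s).differentiableAt, by fun_prop⟩
  · refine lipschitzWith_of_nnnorm_deriv_le (fun s => (hd s).differentiableAt) fun s => ?_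
    rw [hderiv, ← NNReal.coe_le_coe, coe_nnnorm, Real.norm_of_nonneg (mul_nonneg hℓ.le (hf0 s))]
    exact_mod_cast hfle s
  · rw [← hlow (min s R) (min_le_right _ _)]; exact hmono (min_le_left _ _)
  · rw [← hhigh (max s (ℓ - R)) (le_max_right _ _)]; exact hmono (le_max_left _ _)

/-- A `C¹` retraction of space to a segment, up to `η`, that collapses neighbourhoods of the end
points. -/
theorem exists_segment_retraction {a b : E3} (hab : a ≠ b) {η : NNReal} (hη : 0 < η) :
    ∃ R > 0, ∃ F : E3 → E3, ContDiff ℝ 1 F ∧ LipschitzWith (1 + η) F ∧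
      (∀ x, F x ∈ segment ℝ a b) ∧ (∀ x, dist x a ≤ R → F x = a) ∧
      (∀ x, dist x b ≤ R → F x = b) ∧ ∀ x ∈ segment ℝ a b, dist (F x) x ≤ η := by
  set ℓ : ℝ := ‖b - a‖ with hℓdef
  have hℓ : 0 < ℓ := norm_pos_iff.2 (sub_ne_zero.2 hab.symm)
  -- The first bound serves the Lipschitz constant; the second makes the displacement `η₀ * ℓ` along
  -- the segment at most `η`.
  set η₀ : NNReal := min η (η / ⟨ℓ, hℓ.le⟩) with hη₀def
  have hη₀ : 0 < η₀ := lt_min hη (div_pos hη hℓ)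
  have hη₀ℓ : (η₀ : ℝ) * ℓ ≤ η := by
    have : (η₀ : ℝ) ≤ η / ℓ := by
      have := min_le_right η (η / ⟨ℓ, hℓ.le⟩)
      exact_mod_cast this
    rwa [le_div_iff₀ hℓ] at this
  obtain ⟨R, hR, θ, hθc, hθL, hθ0, hθ1, hθm⟩ := exists_collapse hℓ hη₀
  set e : E3 := ℓ⁻¹ • (b - a) with he
  have hen : ‖e‖ = 1 := by
    rw [he, norm_smul, norm_inv, norm_norm, ← hℓdef, inv_mul_cancel₀ hℓ.ne']
  have hℓe : ℓ • e = b - a := by rw [he, smul_smul, mul_inv_cancel₀ hℓ.ne', one_smul]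
  have hin : ∀ x, |inner ℝ x e| ≤ ‖x‖ := fun x => by
    simpa [hen] using abs_real_inner_le_norm x e
  have hee : inner ℝ e e = (1 : ℝ) := by rw [real_inner_self_eq_norm_sq, hen, one_pow]
  refine ⟨R, hR, fun x => a + θ (inner ℝ (x - a) e) • e, ?_, ?_, ?_, ?_, ?_, ?_⟩
  · have : ContDiff ℝ 1 fun x : E3 => inner ℝ (x - a) e :=
      (contDiff_id.sub contDiff_const).inner ℝ contDiff_const
    exact contDiff_const.add ((hθc.comp this).smul contDiff_const)
  · refine LipschitzWith.of_dist_le_mul fun x y => ?_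
    rw [dist_add_left, dist_eq_norm, ← sub_smul, norm_smul, hen, mul_one, ← dist_eq_norm]
    have h1 := hθL.dist_le_mul (inner ℝ (x - a) e) (inner ℝ (y - a) e)
    have h2 : dist (inner ℝ (x - a) e) (inner ℝ (y - a) e) ≤ dist x y := by
      rw [Real.dist_eq, ← inner_sub_left, sub_sub_sub_cancel_right, dist_eq_norm]
      exact hin _
    have h3 : ((1 + η₀ : NNReal) : ℝ) ≤ ((1 + η : NNReal) : ℝ) := by
      exact_mod_cast add_le_add_right (min_le_left _ _) 1
    exact h1.trans (mul_le_mul h3 h2 dist_nonneg (NNReal.coe_nonneg _))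
  · intro x
    rw [segment_eq_image']
    refine ⟨θ (inner ℝ (x - a) e) / ℓ, ⟨div_nonneg (hθm _).1 hℓ.le,
      (div_le_one hℓ).2 (hθm _).2⟩, ?_⟩
    change a + _ • (b - a) = _
    rw [← hℓe, smul_smul, div_mul_cancel₀ _ hℓ.ne']
  · intro x hx
    have : inner ℝ (x - a) e ≤ R := (le_abs_self _).trans ((hin _).trans (by
      rwa [← dist_eq_norm]))
    simp [hθ0 _ this]
  · intro x hx
    have h1 : inner ℝ (x - a) e = inner ℝ (x - b) e + ℓ := by
      have : x - a = (x - b) + ℓ • e := by rw [hℓe]; abel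
      rw [this, inner_add_left, inner_smul_left, hee]; simp
    have h2 : ℓ - R ≤ inner ℝ (x - a) e := by
      have := (neg_le_abs _).trans ((hin (x - b)).trans ((dist_eq_norm x b).symm.trans_le hx))
      rw [h1]; linarith
    change a + θ (inner ℝ (x - a) e) • e = b
    rw [hθ1 _ h2, hℓe]; abel
  · intro x hx
    rw [segment_eq_image'] at hx
    obtain ⟨τ, hτ, rfl⟩ := hx
    have h1 : inner ℝ (a + τ • (b - a) - a) e = τ * ℓ := by
      rw [add_sub_cancel_left, ← hℓe, smul_smul, inner_smul_left, hee]; simp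
    change dist (a + θ (inner ℝ (a + τ • (b - a) - a) e) • e) (a + τ • (b - a)) ≤ η
    have hτe : τ • (b - a) = (τ * ℓ) • e := by rw [mul_smul, hℓe]
    rw [h1, hτe, dist_add_left, dist_eq_norm, ← sub_smul, norm_smul, hen, mul_one,
      Real.norm_eq_abs]
    have hs0 : 0 ≤ τ * ℓ := mul_nonneg hτ.1 hℓ.le
    have hs1 : τ * ℓ ≤ ℓ := mul_le_of_le_one_left hℓ.le hτ.2
    -- Since `θ` fixes `0` and `ℓ`, the Lipschitz bounds from the two ends confine `θ s - s` to
    -- `[-η₀ ℓ, η₀ ℓ]`.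
    have b1 := hθL.dist_le_mul (τ * ℓ) 0
    have b2 := hθL.dist_le_mul ℓ (τ * ℓ)
    rw [hθ0 0 hR.le, Real.dist_eq, Real.dist_eq, sub_zero, sub_zero, abs_of_nonneg hs0] at b1
    rw [hθ1 ℓ (by linarith), Real.dist_eq, Real.dist_eq, abs_of_nonneg (sub_nonneg.2 hs1)] at b2
    push_cast at b1 b2
    have b3 := le_abs_self (θ (τ * ℓ))
    have b4 := le_abs_self (ℓ - θ (τ * ℓ))
    have hη₀' : (0 : ℝ) ≤ η₀ := η₀.2
    refine abs_le.2 ⟨?_, ?_⟩ <;> nlinarith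

/-- Thin tubes about two compact sets meet only near the points common to the two sets. -/
theorem exists_thin_tubes {X : Type*} [PseudoMetricSpace X] {S T : Set X} (hS : IsCompact S)
    (hT : IsClosed T) {R : ℝ} (hR : 0 < R) :
    ∀ᶠ ρ in 𝓝[>] (0 : ℝ), ∀ x ∈ Metric.thickening ρ S, x ∈ Metric.thickening ρ T →
      ∃ z ∈ S ∩ T, dist x z ≤ R := by
  set O : Set X := ⋃ z ∈ S ∩ T, Metric.ball z (R / 2) with hO
  have hOo : IsOpen O := isOpen_biUnion fun _ _ => Metric.isOpen_ball
  -- Away from the common points, what is left of `S` is compact and disjoint from the closed set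
  -- `T`, hence has a thickening disjoint from one of `T`.
  have hdisj : Disjoint (S \ O) T := disjoint_left.2 fun z hz hzT =>
    hz.2 (mem_biUnion (⟨hz.1, hzT⟩ : z ∈ S ∩ T) (Metric.mem_ball_self (half_pos hR)))
  obtain ⟨δ, hδ, hd⟩ := hdisj.exists_thickenings (hS.diff hOo) hT
  have hmin : 0 < min δ (R / 2) := lt_min hδ (half_pos hR)
  filter_upwards [Ioo_mem_nhdsGT hmin] with ρ hρ x hxS hxT
  obtain ⟨z, hz, hxz⟩ := Metric.mem_thickening_iff.1 hxS
  by_cases hzO : z ∈ O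
  · obtain ⟨v, hv, hzv⟩ := mem_iUnion₂.1 hzO
    refine ⟨v, hv, (dist_triangle x z v).trans ?_⟩
    have h1 : ρ ≤ R / 2 := hρ.2.le.trans (min_le_right _ _)
    have h2 := Metric.mem_ball.1 hzv
    linarith
  · have hle : ρ ≤ δ := hρ.2.le.trans (min_le_left _ _)
    exact absurd (Metric.thickening_mono hle _ hxT) (disjoint_left.1 hd
      (Metric.mem_thickening_iff.2 ⟨z, ⟨hz, hzO⟩, hxz.trans_le hle⟩))

theorem isCompact_segment (a b : E3) : IsCompact (segment ℝ a b) := by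
  rw [segment_eq_image_lineMap]
  exact isCompact_Icc.image AffineMap.lineMap_continuous

/-! ### The network and its retraction to the graph -/

namespace EmbeddedMetricGraph

variable {V : Type*} (G : EmbeddedMetricGraph V)

theorem pos_mem_carrier (v : V) : G.pos v ∈ G.carrier := Or.inl (mem_range_self v)

theorem carrier_nonempty : G.carrier.Nonempty :=
  let ⟨v⟩ := G.connected.nonempty
  ⟨_, G.pos_mem_carrier v⟩

theorem segment_subset_carrier {u v : V} (h : G.graph.Adj u v) :
    segment ℝ (G.pos u) (G.pos v) ⊆ G.carrier := fun _ hx => Or.inr ⟨u, v, h, hx⟩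

theorem network_zero : G.network 0 = G.carrier := by
  simp [network]

theorem network_mono {ε ε' : ℝ} (h : ε ≤ ε') : G.network ε ⊆ G.network ε' :=
  add_subset_add_left (Metric.closedBall_subset_closedBall h)

theorem mem_network_iff {ε : ℝ} {x : E3} : x ∈ G.network ε ↔ ∃ p ∈ G.carrier, dist x p ≤ ε := by
  constructor
  · rintro ⟨p, hp, z, hz, rfl⟩
    exact ⟨p, hp, by simpa using hz⟩
  · rintro ⟨p, hp, h⟩
    exact ⟨p, hp, x - p, by simpa [dist_eq_norm] using h, by simp⟩

theorem carrier_subset_network {ε : ℝ} (hε : 0 ≤ ε) : G.carrier ⊆ G.network ε := fun x hx =>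
  G.mem_network_iff.2 ⟨x, hx, by simpa using hε⟩

theorem closedBall_subset_network {ε : ℝ} {p : E3} (hp : p ∈ G.carrier) :
    Metric.closedBall p ε ⊆ G.network ε := fun _ hx => G.mem_network_iff.2 ⟨p, hp, hx⟩

theorem network_subset_thickening {ε ρ : ℝ} (h : ε < ρ) :
    G.network ε ⊆ Metric.thickening ρ G.carrier := fun _ hx =>
  let ⟨p, hp, hxp⟩ := G.mem_network_iff.1 hx
  Metric.mem_thickening_iff.2 ⟨p, hp, hxp.trans_lt h⟩

variable [Finite V]

theorem isCompact_carrier : IsCompact G.carrier := by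
  refine (finite_range _).isCompact.union ?_
  have : {x | ∃ u v : V, G.graph.Adj u v ∧ x ∈ segment ℝ (G.pos u) (G.pos v)} =
      ⋃ p ∈ {p : V × V | G.graph.Adj p.1 p.2}, segment ℝ (G.pos p.1) (G.pos p.2) := by
    ext x; simp
  rw [this]
  exact (toFinite _).isCompact_biUnion fun p _ => isCompact_segment _ _

theorem isCompact_network (ε : ℝ) : IsCompact (G.network ε) :=
  G.isCompact_carrier.add (isCompact_closedBall _ _)

/-- A `C¹` map of a neighbourhood of the graph to the graph that is almost the identity and
stretches by a factor close to `1` at most. -/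
theorem exists_retraction {η : NNReal} (hη : 0 < η) :
    ∃ ρ > 0, ∃ Ψ : E3 → E3, ContDiffOn ℝ 1 Ψ (Metric.thickening ρ G.carrier) ∧
      (∀ x, Ψ x ∈ G.carrier) ∧
      (∀ x ∈ Metric.thickening ρ G.carrier, ‖fderiv ℝ Ψ x‖₊ ≤ 1 + η) ∧
      ∀ x ∈ Metric.thickening ρ G.carrier, dist (Ψ x) x ≤ 2 * η := by
  have hη' : (0 : ℝ) < η := hη
  -- A single vertex lies on no edge and is treated apart. Otherwise connectedness puts every vertex
  -- on an edge, so the edges cover the graph.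
  rcases subsingleton_or_nontrivial V with hV | hV
  · obtain ⟨v⟩ := G.connected.nonempty
    have hc : G.carrier = {G.pos v} := by
      refine Subset.antisymm ?_ (singleton_subset_iff.2 (G.pos_mem_carrier v))
      rintro x (⟨u, rfl⟩ | ⟨u, w, huw, -⟩)
      · rw [Subsingleton.elim u v]; rfl
      · exact absurd (Subsingleton.elim u w) huw.ne
    refine ⟨η, hη', fun _ => G.pos v, contDiffOn_const, fun _ => G.pos_mem_carrier v,
      fun x _ => by simp, fun x hx => ?_⟩
    rw [hc, Metric.thickening_singleton, Metric.mem_ball, dist_comm] at hx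
    linarith
  have hrep : ∀ e : G.graph.edgeSet, ∃ p : V × V, s(p.1, p.2) = e.1 := fun e => by
    induction e.1 using Sym2.ind with
    | _ a b => exact ⟨(a, b), rfl⟩
  choose p hp using hrep
  have hadj : ∀ e, G.graph.Adj (p e).1 (p e).2 := fun e => by
    rw [← SimpleGraph.mem_edgeSet, hp]; exact e.2
  set S : G.graph.edgeSet → Set E3 := fun e => segment ℝ (G.pos (p e).1) (G.pos (p e).2) with hS
  have hScomp : ∀ e, IsCompact (S e) := fun e => isCompact_segment _ _
  have hSsub : ∀ e, S e ⊆ G.carrier := fun e => G.segment_subset_carrier (hadj e)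
  have hcov : ∀ x ∈ G.carrier, ∃ e, x ∈ S e := by
    have hedge : ∀ u v, G.graph.Adj u v → ∀ x ∈ segment ℝ (G.pos u) (G.pos v),
        ∃ e, x ∈ S e := fun u v huv x hx => by
      refine ⟨⟨s(u, v), huv⟩, ?_⟩
      rcases Sym2.eq_iff.1 (hp ⟨s(u, v), huv⟩) with ⟨h1, h2⟩ | ⟨h1, h2⟩
      · simpa only [hS, h1, h2] using hx
      · simpa only [hS, h1, h2, segment_symm] using hx
    rintro x (⟨v, rfl⟩ | ⟨u, v, huv, hx⟩)
    · obtain ⟨w, hw⟩ := G.connected.preconnected.exists_adj_of_nontrivial v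
      exact hedge v w hw _ (left_mem_segment _ _ _)
    · exact hedge u v huv x hx
  choose R hR F hFc hFL hFm hFa hFb hFd using fun e : G.graph.edgeSet =>
    exists_segment_retraction (G.pos_injective.ne (hadj e).ne) hη
  have hFv : ∀ e, ∀ v ∈ ({(p e).1, (p e).2} : Set V), ∀ x, dist x (G.pos v) ≤ R e →
      F e x = G.pos v := by
    rintro e v (rfl | rfl) x hx
    · exact hFa e x hx
    · exact hFb e x hx
  -- Thin tubes of two edges overlap only near a common vertex, and there both edge maps are
  -- constantly that vertex.
  have hpair : ∀ᶠ ρ in 𝓝[>] (0 : ℝ), ∀ e e', e ≠ e' → ∀ x ∈ Metric.thickening ρ (S e),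
      x ∈ Metric.thickening ρ (S e') → F e x = F e' x := by
    refine eventually_all.2 fun e => eventually_all.2 fun e' => ?_
    by_cases hee : e = e'
    · exact Eventually.of_forall fun ρ h => absurd hee h
    filter_upwards [exists_thin_tubes (hScomp e) (hScomp e').isClosed (lt_min (hR e) (hR e'))]
      with ρ hρ _ x hx hx'
    obtain ⟨z, hz, hxz⟩ := hρ x hx hx'
    obtain ⟨v, hv, rfl⟩ := G.segment_inter_segment _ _ _ _ (hadj e) (hadj e')
      (by rw [hp, hp]; exact fun h => hee (Subtype.ext h)) hz
    rw [hFv e v hv.1 x (hxz.trans (min_le_left _ _)),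
      hFv e' v hv.2 x (hxz.trans (min_le_right _ _))]
  -- The displacement of a point in a tube is at most `(1 + η)ρ + η + ρ`, which this bound keeps
  -- below `2η`.
  have hsmall : ∀ᶠ ρ in 𝓝[>] (0 : ℝ), ρ ∈ Ioo 0 (η / (2 + η : ℝ)) :=
    Ioo_mem_nhdsGT (by positivity)
  obtain ⟨ρ, hFF, hρ0, hρ1⟩ := (hpair.and hsmall).exists
  rw [lt_div_iff₀ (by positivity)] at hρ1
  have hth : ∀ x ∈ Metric.thickening ρ G.carrier, ∃ e, x ∈ Metric.thickening ρ (S e) := by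
    intro x hx
    obtain ⟨z, hz, hxz⟩ := Metric.mem_thickening_iff.1 hx
    obtain ⟨e, he⟩ := hcov z hz
    exact ⟨e, Metric.mem_thickening_iff.2 ⟨z, he, hxz⟩⟩
  obtain ⟨x₀, hx₀⟩ := G.carrier_nonempty
  obtain ⟨e₀, -⟩ := hcov x₀ hx₀
  have hsel : ∀ x, ∃ e, x ∈ Metric.thickening ρ G.carrier → x ∈ Metric.thickening ρ (S e) :=
    fun x => by
      by_cases hx : x ∈ Metric.thickening ρ G.carrier
      · obtain ⟨e, he⟩ := hth x hx
        exact ⟨e, fun _ => he⟩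
      · exact ⟨e₀, fun h => absurd h hx⟩
  choose σ hσ using hsel
  -- By `hFF` the value on the tubes does not depend on the selected edge, so `Ψ` agrees locally
  -- with a single `C¹` edge map.
  set Ψ : E3 → E3 := fun x => F (σ x) x with hΨ
  have hΨF : ∀ e, ∀ x ∈ Metric.thickening ρ (S e), Ψ x = F e x := fun e x hx => by
    by_cases h : σ x = e
    · simp only [hΨ, h]
    · exact hFF _ _ h x (hσ x (Metric.thickening_subset_of_subset ρ (hSsub e) hx)) hx
  have hloc : ∀ x ∈ Metric.thickening ρ G.carrier, ∃ e, x ∈ Metric.thickening ρ (S e) ∧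
      Ψ =ᶠ[𝓝 x] F e := fun x hx => by
    obtain ⟨e, he⟩ := hth x hx
    refine ⟨e, he, ?_⟩
    filter_upwards [Metric.isOpen_thickening.mem_nhds he] with y hy using hΨF e y hy
  refine ⟨ρ, hρ0, Ψ, fun x hx => ?_, fun x => hSsub _ (hFm _ x), fun x hx => ?_, fun x hx => ?_⟩
  · obtain ⟨e, -, he⟩ := hloc x hx
    exact ((hFc e).contDiffAt.congr_of_eventuallyEq he).contDiffWithinAt
  · obtain ⟨e, -, he⟩ := hloc x hx
    rw [he.fderiv_eq]
    exact norm_fderiv_le_of_lipschitz ℝ (hFL e)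
  · obtain ⟨e, hxe, he⟩ := hloc x hx
    rw [he.eq_of_nhds]
    obtain ⟨z, hz, hxz⟩ := Metric.mem_thickening_iff.1 hxe
    have h1 := (hFL e).dist_le_mul x z
    have h2 := hFd e z hz
    have h3 := dist_triangle4 (F e x) (F e z) z x
    rw [dist_comm z x] at h3
    push_cast at h1
    nlinarith

/-! ### Local smallness and boundedness of the costs -/

/-- Points of the graph near a given point `z` of the graph are joined to `z` by a segment within
the graph. -/
theorem eventually_segment_subset (z : E3) :
    ∀ᶠ q in 𝓝 z, q ∈ G.carrier → segment ℝ z q ⊆ G.carrier := by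
  have h1 : ∀ᶠ q in 𝓝 z, ∀ v : V, q = G.pos v → z = q := by
    refine eventually_all.2 fun v => ?_
    by_cases h : z = G.pos v
    · exact Eventually.of_forall fun q hq => h.trans hq.symm
    · filter_upwards [isOpen_ne.mem_nhds h] with q hq hq' using absurd hq' hq
  have h2 : ∀ᶠ q in 𝓝 z, ∀ u v : V, G.graph.Adj u v → q ∈ segment ℝ (G.pos u) (G.pos v) →
      z ∈ segment ℝ (G.pos u) (G.pos v) := by
    refine eventually_all.2 fun u => eventually_all.2 fun v => ?_
    by_cases h : z ∈ segment ℝ (G.pos u) (G.pos v)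
    · exact Eventually.of_forall fun q _ _ => h
    · filter_upwards [(isCompact_segment _ _).isClosed.isOpen_compl.mem_nhds h] with q hq _ hq'
        using absurd hq' hq
  filter_upwards [h1, h2] with q hq1 hq2 hq
  rcases hq with ⟨v, rfl⟩ | ⟨u, v, huv, hq⟩
  · rw [hq1 v rfl, segment_same]
    exact singleton_subset_iff.2 (G.pos_mem_carrier v)
  · exact ((convex_segment _ _).segment_subset (hq2 u v huv hq) hq).trans
      (G.segment_subset_carrier huv)

theorem enorm_sub_sq_le {x y : E3} {r : ℝ} (h : dist x y ≤ r) :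
    ‖y - x‖ₑ ^ 2 ≤ ENNReal.ofReal (r ^ 2) := by
  rw [← edist_eq_enorm_sub, edist_dist, dist_comm, ← ENNReal.ofReal_pow dist_nonneg]
  exact ENNReal.ofReal_le_ofReal (by gcongr)

/-- The cost of the graph is small for nearby points. -/
theorem exists_costOn_carrier_le {κ : ℝ} (hκ : 0 < κ) :
    ∃ r > 0, ∀ p ∈ G.carrier, ∀ q ∈ G.carrier, dist p q < r →
      costOn G.carrier p q ≤ ENNReal.ofReal κ := by
  -- Two segments of length at most `s`, each run in half the time, cost at most `2s² + 2s² = κ`.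
  set s : ℝ := √(κ / 4) with hs
  have hs0 : 0 < s := Real.sqrt_pos.2 (by positivity)
  have hs2 : 2 * s ^ 2 + 2 * s ^ 2 = κ := by
    rw [hs, Real.sq_sqrt (by positivity)]; ring
  have hU : ∀ z : G.carrier, ∃ U : Set E3, IsOpen U ∧ z.1 ∈ U ∧ U ⊆ Metric.ball z.1 s ∧
      ∀ q ∈ U, q ∈ G.carrier → segment ℝ z.1 q ⊆ G.carrier := fun z => by
    obtain ⟨U, hU, hUo, hzU⟩ := mem_nhds_iff.1
      ((G.eventually_segment_subset z.1).and (Metric.ball_mem_nhds z.1 hs0))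
    exact ⟨U, hUo, hzU, fun q hq => (hU hq).2, fun q hq => (hU hq).1⟩
  choose U hUo hzU hUb hUs using hU
  -- Below the Lebesgue number, `p` and `q` lie in one set `U z` and are joined through `z`.
  obtain ⟨r, hr, h⟩ := lebesgue_number_lemma_of_metric G.isCompact_carrier hUo
    fun z hz => mem_iUnion.2 ⟨⟨z, hz⟩, hzU _⟩
  refine ⟨r, hr, fun p hp q hq hpq => ?_⟩
  obtain ⟨z, hz⟩ := h p hp
  have hpU := hz (Metric.mem_ball_self hr)
  have hqU : q ∈ U z := hz (by rwa [Metric.mem_ball, dist_comm])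
  have c1 : costOn G.carrier p z ≤ ENNReal.ofReal (s ^ 2) :=
    (costOn_le_of_segment_subset (by
      rw [segment_symm]; exact hUs z p hpU hp)).trans (enorm_sub_sq_le (hUb z hpU).le)
  have c2 : costOn G.carrier z q ≤ ENNReal.ofReal (s ^ 2) :=
    (costOn_le_of_segment_subset (hUs z q hqU hq)).trans
      (enorm_sub_sq_le (by rw [dist_comm]; exact (hUb z hqU).le))
  calc costOn G.carrier p q ≤ _ :=
        costOn_triangle _ p z q (one_half_pos (α := ℝ)) one_half_lt_one
    _ ≤ ENNReal.ofReal (1 / 2 : ℝ)⁻¹ * ENNReal.ofReal (s ^ 2) +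
        ENNReal.ofReal (1 - 1 / 2 : ℝ)⁻¹ * ENNReal.ofReal (s ^ 2) := by gcongr
    _ = ENNReal.ofReal κ := by
        rw [← ENNReal.ofReal_mul (by norm_num), ← ENNReal.ofReal_mul (by norm_num),
          ← ENNReal.ofReal_add (by positivity) (by positivity), ← hs2]
        norm_num

theorem costOn_ne_top_trans {U : Set E3} {x y z : E3} (h₁ : costOn U x y ≠ ⊤)
    (h₂ : costOn U y z ≠ ⊤) : costOn U x z ≠ ⊤ := by
  refine ne_top_of_le_ne_top ?_ (costOn_triangle U x y z one_half_pos one_half_lt_one)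
  finiteness

theorem costOn_ne_top_of_segment_subset {U : Set E3} {x y : E3} (h : segment ℝ x y ⊆ U) :
    costOn U x y ≠ ⊤ :=
  ne_top_of_le_ne_top (by finiteness) (costOn_le_of_segment_subset h)

/-- The cost of the graph is bounded. -/
theorem exists_costOn_carrier_bound :
    ∃ M : ℝ, ∀ p ∈ G.carrier, ∀ q ∈ G.carrier, costOn G.carrier p q ≤ ENNReal.ofReal M := by
  have hvert : ∀ u v, costOn G.carrier (G.pos u) (G.pos v) ≠ ⊤ := fun u v => by
    obtain ⟨w⟩ := G.connected.preconnected u v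
    induction w with
    | nil =>
      exact costOn_ne_top_of_segment_subset (by simpa using G.pos_mem_carrier _)
    | cons h _ ih =>
      exact costOn_ne_top_trans
        (costOn_ne_top_of_segment_subset (G.segment_subset_carrier h)) ih
  obtain ⟨v₀⟩ := G.connected.nonempty
  have hfin : ∀ p ∈ G.carrier, ∀ q ∈ G.carrier, costOn G.carrier p q ≠ ⊤ := by
    have h1 : ∀ p ∈ G.carrier, ∃ v, segment ℝ (G.pos v) p ⊆ G.carrier := by
      rintro p (⟨v, rfl⟩ | ⟨u, v, huv, hp⟩)
      · exact ⟨v, by simpa using G.pos_mem_carrier v⟩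
      · exact ⟨u, ((convex_segment _ _).segment_subset (left_mem_segment _ _ _) hp).trans
          (G.segment_subset_carrier huv)⟩
    intro p hp q hq
    obtain ⟨u, hu⟩ := h1 p hp
    obtain ⟨v, hv⟩ := h1 q hq
    exact costOn_ne_top_trans (costOn_ne_top_of_segment_subset (by rwa [segment_symm]))
      (costOn_ne_top_trans (hvert u v) (costOn_ne_top_of_segment_subset hv))
  obtain ⟨r, hr, hloc⟩ := G.exists_costOn_carrier_le one_pos
  obtain ⟨t, htc, htf, ht⟩ := G.isCompact_carrier.finite_cover_balls hr
  have hcov : ∀ p ∈ G.carrier, ∃ z ∈ t, dist p z < r := fun p hp => by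
    simpa using ht hp
  -- The finite sum bounds the cost between any two points of the finite net; arbitrary points are
  -- joined through nearby net points.
  set A : ℝ≥0∞ := ∑ z ∈ htf.toFinset, ∑ w ∈ htf.toFinset, costOn G.carrier z w with hA
  have hAt : A ≠ ⊤ := ENNReal.sum_ne_top.2 fun z hz => ENNReal.sum_ne_top.2 fun w hw =>
    hfin z (htc (htf.mem_toFinset.1 hz)) w (htc (htf.mem_toFinset.1 hw))
  set B : ℝ≥0∞ := ENNReal.ofReal (1 / 2 : ℝ)⁻¹ * ENNReal.ofReal 1 + ENNReal.ofReal (1 - 1 / 2 : ℝ)⁻¹ *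
    (ENNReal.ofReal (1 / 2 : ℝ)⁻¹ * A + ENNReal.ofReal (1 - 1 / 2 : ℝ)⁻¹ * ENNReal.ofReal 1) with hB
  have hBt : B ≠ ⊤ := by finiteness
  refine ⟨B.toReal, fun p hp q hq => ?_⟩
  rw [ENNReal.ofReal_toReal hBt]
  obtain ⟨z, hz, hpz⟩ := hcov p hp
  obtain ⟨w, hw, hqw⟩ := hcov q hq
  have hzw : costOn G.carrier z w ≤ A :=
    (Finset.single_le_sum (f := fun w => costOn G.carrier z w) (fun _ _ => zero_le)
      (htf.mem_toFinset.2 hw)).trans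
    (Finset.single_le_sum (f := fun z => ∑ w ∈ htf.toFinset, costOn G.carrier z w)
      (fun _ _ => zero_le) (htf.mem_toFinset.2 hz))
  refine (costOn_triangle _ p z q one_half_pos one_half_lt_one).trans
    (add_le_add (mul_le_mul_right (hloc p hp z (htc hz) hpz) _) (mul_le_mul_right ?_ _))
  exact (costOn_triangle _ z w q one_half_pos one_half_lt_one).trans
    (add_le_add (mul_le_mul_right hzw _) (mul_le_mul_right
      (hloc w (htc hw) q hq (by rwa [dist_comm])) _))

/-- The cost of the network is small for a point of the network and a nearby point of the graph. -/
theorem exists_costOn_network_le {κ : ℝ} (hκ : 0 < κ) :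
    ∃ r > 0, ∀ ε, 0 ≤ ε → ε < r → ∀ x ∈ G.network ε, ∀ p ∈ G.carrier, dist x p < r →
      costOn (G.network ε) x p ≤ ENNReal.ofReal κ ∧
        costOn (G.network ε) p x ≤ ENNReal.ofReal κ := by
  obtain ⟨r, hr, h⟩ := G.exists_costOn_carrier_le (κ := κ / 4) (by positivity)
  set s : ℝ := √(κ / 4) with hs
  have hs0 : 0 < s := Real.sqrt_pos.2 (by positivity)
  have hs2 : 2 * s ^ 2 + 2 * (κ / 4) = κ := by
    rw [hs, Real.sq_sqrt (by positivity)]; ring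
  have hle : ENNReal.ofReal (1 / 2 : ℝ)⁻¹ * ENNReal.ofReal (s ^ 2) +
      ENNReal.ofReal (1 - 1 / 2 : ℝ)⁻¹ * ENNReal.ofReal (κ / 4) = ENNReal.ofReal κ := by
    rw [← ENNReal.ofReal_mul (by norm_num), ← ENNReal.ofReal_mul (by norm_num),
      ← ENNReal.ofReal_add (by positivity) (by positivity)]
    congr 1
    linarith
  have hle' : ENNReal.ofReal (1 / 2 : ℝ)⁻¹ * ENNReal.ofReal (κ / 4) +
      ENNReal.ofReal (1 - 1 / 2 : ℝ)⁻¹ * ENNReal.ofReal (s ^ 2) = ENNReal.ofReal κ := by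
    rw [← ENNReal.ofReal_mul (by norm_num), ← ENNReal.ofReal_mul (by norm_num),
      ← ENNReal.ofReal_add (by positivity) (by positivity)]
    congr 1
    linarith
  -- The curve passes through a point `q` of the graph with `dist x q ≤ ε`. The first piece stays in
  -- the ball about `q`, and `dist q p < r` controls the second.
  refine ⟨min s (r / 2), lt_min hs0 (half_pos hr), fun ε hε0 hε x hx p hp hxp => ?_⟩
  obtain ⟨q, hq, hxq⟩ := G.mem_network_iff.1 hx
  have hεs : ε ≤ s := hε.le.trans (min_le_left _ _)
  have hqp : dist q p < r := by
    have h1 := dist_triangle_left q p x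
    have h2 := hxp.trans_le (min_le_right _ _)
    have h3 := hε.trans_le (min_le_right _ _)
    linarith
  have hsub := G.carrier_subset_network hε0
  have hseg : segment ℝ x q ⊆ G.network ε :=
    ((convex_closedBall q ε).segment_subset hxq (Metric.mem_closedBall_self hε0)).trans
      (G.closedBall_subset_network hq)
  have c1 : costOn (G.network ε) x q ≤ ENNReal.ofReal (s ^ 2) :=
    (costOn_le_of_segment_subset hseg).trans (enorm_sub_sq_le (hxq.trans hεs))
  have c2 : costOn (G.network ε) q x ≤ ENNReal.ofReal (s ^ 2) :=
    (costOn_le_of_segment_subset (by rwa [segment_symm])).trans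
      (enorm_sub_sq_le (by rw [dist_comm]; exact hxq.trans hεs))
  have c3 := (costOn_anti hsub q p).trans (h q hq p hp hqp)
  have c4 := (costOn_anti hsub p q).trans (h p hp q hq (by rwa [dist_comm]))
  constructor
  · rw [← hle]
    exact (costOn_triangle _ x q p one_half_pos one_half_lt_one).trans
      (add_le_add (mul_le_mul_right c1 _) (mul_le_mul_right c3 _))
  · rw [← hle']
    exact (costOn_triangle _ p q x one_half_pos one_half_lt_one).trans
      (add_le_add (mul_le_mul_right c4 _) (mul_le_mul_right c2 _))

end EmbeddedMetricGraph

/-! ### Uniform closeness of the costs -/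

/-- Moving the end points by a small cost changes a bounded cost only a little. -/
theorem exists_costOn_le_add (M : ℝ) {δ : ℝ} (hδ : 0 < δ) :
    ∃ l > 0, ∀ (U : Set E3) (x x' y y' : E3) (C : ℝ≥0∞), C ≤ ENNReal.ofReal M →
      costOn U x x' ≤ ENNReal.ofReal (l ^ 2) → costOn U y' y ≤ ENNReal.ofReal (l ^ 2) →
      costOn U x' y' ≤ ENNReal.ofReal ((1 + l) ^ 2) * C → costOn U x y ≤ C + ENNReal.ofReal δ := by
  -- `g l` bounds the excess over `C` when both end pieces get time fraction `l` in the two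
  -- successive concatenations `t1` and `t2`.
  set g : ℝ → ℝ := fun l =>
    l + (1 - l)⁻¹ * l + max M 0 * ((1 - l)⁻¹ * (1 - l)⁻¹ * (1 + l) ^ 2 - 1) with hg
  have hgc : ContinuousAt g 0 := by
    have : ContinuousAt (fun l : ℝ => (1 - l)⁻¹) 0 :=
      ContinuousAt.inv₀ (by fun_prop) (by norm_num)
    fun_prop
  have hg0 : g 0 = 0 := by simp [hg]
  have hev : ∀ᶠ l in 𝓝[>] (0 : ℝ), g l < δ ∧ l ∈ Ioo (0 : ℝ) 1 := by
    refine (Filter.Eventually.filter_mono nhdsWithin_le_nhds ?_).and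
      (Ioo_mem_nhdsGT zero_lt_one)
    exact hgc.tendsto.eventually_lt_const (by rwa [hg0])
  obtain ⟨l, hgl, hl0, hl1⟩ := hev.exists
  have hl1' : 0 < 1 - l := sub_pos.2 hl1
  refine ⟨l, hl0, fun U x x' y y' C hC h1 h2 h3 => ?_⟩
  have hCt : C ≠ ⊤ := ne_top_of_le_ne_top ENNReal.ofReal_ne_top hC
  set c : ℝ := C.toReal with hc
  have hc0 : 0 ≤ c := ENNReal.toReal_nonneg
  have hcM : c ≤ max M 0 := by
    rw [← ENNReal.toReal_ofReal']
    exact ENNReal.toReal_mono ENNReal.ofReal_ne_top hC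
  have hCc : C = ENNReal.ofReal c := (ENNReal.ofReal_toReal hCt).symm
  have t1 := costOn_triangle U x x' y hl0 hl1
  have t2 := costOn_triangle U x' y' y hl1' (by linarith)
  rw [sub_sub_cancel] at t2
  have hinv : l⁻¹ * l ^ 2 = l := by field_simp
  have s2 : costOn U x' y ≤ ENNReal.ofReal ((1 - l)⁻¹ * ((1 + l) ^ 2 * c) + l) := by
    rw [ENNReal.ofReal_add (by positivity) hl0.le, ENNReal.ofReal_mul (by positivity),
      ENNReal.ofReal_mul (by positivity), ← hCc]
    refine t2.trans (add_le_add (mul_le_mul_right h3 _) ((mul_le_mul_right h2 _).trans_eq ?_))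
    rw [← ENNReal.ofReal_mul (by positivity), hinv]
  have s1 : costOn U x y ≤
      ENNReal.ofReal (l + (1 - l)⁻¹ * ((1 - l)⁻¹ * ((1 + l) ^ 2 * c) + l)) := by
    rw [ENNReal.ofReal_add hl0.le (by positivity), ENNReal.ofReal_mul (p := (1 - l)⁻¹)
      (by positivity)]
    refine t1.trans (add_le_add ((mul_le_mul_right h1 _).trans_eq ?_) (mul_le_mul_right s2 _))
    rw [← ENNReal.ofReal_mul (by positivity), hinv]
  rw [hCc, ← ENNReal.ofReal_add hc0 hδ.le]
  refine s1.trans (ENNReal.ofReal_le_ofReal ?_)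
  have hfac : 0 ≤ (1 - l)⁻¹ * (1 - l)⁻¹ * (1 + l) ^ 2 - 1 := by
    have h1 : 1 ≤ (1 - l)⁻¹ := (one_le_inv₀ hl1').2 (by linarith)
    have h2 : 1 ≤ (1 + l) ^ 2 := one_le_pow₀ (by linarith)
    have h3 := one_le_mul_of_one_le_of_one_le (one_le_mul_of_one_le_of_one_le h1 h1) h2
    linarith
  have := mul_le_mul_of_nonneg_right hcM hfac
  simp only [hg] at hgl
  linarith

namespace EmbeddedMetricGraph

variable {V : Type*} [Finite V] (G : EmbeddedMetricGraph V)

/-- The costs of the network and of the graph are uniformly close. -/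
theorem exists_cost_close {δ : ℝ} (hδ : 0 < δ) :
    ∃ r > 0, ∀ ε, 0 ≤ ε → ε < r → ∀ x ∈ G.network ε, ∀ y ∈ G.network ε,
      ∀ x' ∈ G.carrier, ∀ y' ∈ G.carrier, dist x x' < r → dist y y' < r →
        G.cost ε x y ≤ G.cost 0 x' y' + ENNReal.ofReal δ ∧
          G.cost 0 x' y' ≤ G.cost ε x y + ENNReal.ofReal δ := by
  obtain ⟨M₀, hM₀⟩ := G.exists_costOn_carrier_bound
  set M : ℝ := max M₀ 0 with hMdef
  have hM : ∀ p ∈ G.carrier, ∀ q ∈ G.carrier, costOn G.carrier p q ≤ ENNReal.ofReal M :=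
    fun p hp q hq => (hM₀ p hp q hq).trans (ENNReal.ofReal_le_ofReal (le_max_left _ _))
  -- The lemma is used twice. In the second use `C` is the network cost, which the first use bounds
  -- by `M + min δ 1 ≤ M + 1`.
  obtain ⟨l, hl, hsand⟩ := exists_costOn_le_add (M + 1) (lt_min hδ one_pos)
  obtain ⟨r₁, hr₁, hnet⟩ := G.exists_costOn_network_le (pow_pos hl 2)
  obtain ⟨r₀, hr₀, hcar⟩ := G.exists_costOn_carrier_le (pow_pos hl 2)
  -- `η ≤ l` bounds the stretching by `1 + l`; `η ≤ r₀ / 4` keeps the displacement `2η` within `r₀ /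
  -- 2`.
  set η : NNReal := min ⟨l, hl.le⟩ ⟨r₀ / 4, by positivity⟩ with hη
  have hη0 : 0 < η := lt_min hl (show (0 : ℝ) < r₀ / 4 by positivity)
  have hηl : (η : ℝ) ≤ l := by exact_mod_cast min_le_left _ _
  have hηr : (η : ℝ) ≤ r₀ / 4 := by
    have := min_le_right (⟨l, hl.le⟩ : NNReal) ⟨r₀ / 4, by positivity⟩
    exact_mod_cast this
  obtain ⟨ρ, hρ, Ψ, hΨc, hΨm, hΨd, hΨx⟩ := G.exists_retraction hη0
  refine ⟨min (min r₁ ρ) (r₀ / 2), lt_min (lt_min hr₁ hρ) (half_pos hr₀),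
    fun ε hε0 hε x hx y hy x' hx' y' hy' hxx hyy => ?_⟩
  have hmin₁ : min (min r₁ ρ) (r₀ / 2) ≤ r₁ := (min_le_left _ _).trans (min_le_left _ _)
  have hmin₂ : min (min r₁ ρ) (r₀ / 2) ≤ ρ := (min_le_left _ _).trans (min_le_right _ _)
  have hmin₃ : min (min r₁ ρ) (r₀ / 2) ≤ r₀ / 2 := min_le_right _ _
  have hthick := G.network_subset_thickening (hε.trans_le hmin₂)
  change costOn (G.network ε) x y ≤ costOn (G.network 0) x' y' + _ ∧
    costOn (G.network 0) x' y' ≤ costOn (G.network ε) x y + _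
  rw [G.network_zero]
  have one_le : (1 : ℝ≥0∞) ≤ ENNReal.ofReal ((1 + l) ^ 2) :=
    ENNReal.one_le_ofReal.2 (one_le_pow₀ (by linarith))
  have up := hsand (G.network ε) x x' y y' (costOn G.carrier x' y')
    ((hM x' hx' y' hy').trans (ENNReal.ofReal_le_ofReal (by linarith)))
    (hnet ε hε0 (hε.trans_le hmin₁) x hx x' hx' (hxx.trans_le hmin₁)).1
    (hnet ε hε0 (hε.trans_le hmin₁) y hy y' hy' (hyy.trans_le hmin₁)).2
    ((costOn_anti (G.carrier_subset_network hε0) _ _).trans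
      (le_mul_of_one_le_left zero_le one_le))
  have hδ' : ∀ C : ℝ≥0∞, C + ENNReal.ofReal (min δ 1) ≤ C + ENNReal.ofReal δ := fun C =>
    add_le_add le_rfl (ENNReal.ofReal_le_ofReal (min_le_left _ _))
  refine ⟨up.trans (hδ' _), le_trans ?_ (hδ' _)⟩
  have hbound : costOn (G.network ε) x y ≤ ENNReal.ofReal (M + 1) := by
    rw [ENNReal.ofReal_add (le_max_right _ _) zero_le_one]
    exact up.trans (add_le_add (hM x' hx' y' hy') (ENNReal.ofReal_le_ofReal (min_le_right _ _)))
  have hnear : ∀ z ∈ G.network ε, ∀ z', dist z z' < min (min r₁ ρ) (r₀ / 2) →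
      dist z' (Ψ z) < r₀ := fun z hz z' hzz => by
    have h1 := dist_triangle z' z (Ψ z)
    have h2 := hΨx z (hthick hz)
    rw [dist_comm z' z, dist_comm z (Ψ z)] at h1
    linarith
  refine hsand G.carrier x' (Ψ x) y' (Ψ y) (costOn (G.network ε) x y) hbound
    (hcar _ hx' _ (hΨm x) (hnear x hx x' hxx))
    (hcar _ (hΨm y) _ hy' (by rw [dist_comm]; exact hnear y hy y' hyy)) ?_
  refine (costOn_map_le (U := G.network ε) (G.isCompact_network ε).isClosed
    Metric.isOpen_thickening hthick hΨc (fun x _ => hΨm x) (K := 1 + η) (by positivity)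
    (fun z hz => hΨd z (hthick hz)) x y).trans (mul_le_mul_left ?_ _)
  rw [ENNReal.ofReal_pow (by positivity)]
  gcongr
  rw [← ENNReal.ofReal_coe_nnreal]
  exact ENNReal.ofReal_le_ofReal (by push_cast; linarith)

end EmbeddedMetricGraph

/-! ### Passage to the limit -/

theorem OT_le_ofReal {μ ν : Measure E3} [IsProbabilityMeasure μ] [IsProbabilityMeasure ν]
    {N : Set E3} (hμ : ∀ᵐ x ∂μ, x ∈ N) (hν : ∀ᵐ x ∂ν, x ∈ N) {c : E3 → E3 → ℝ≥0∞} {M : ℝ}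
    (hc : ∀ x ∈ N, ∀ y ∈ N, c x y ≤ ENNReal.ofReal M) : OT μ ν c ≤ ENNReal.ofReal M := by
  have h1 : (μ.prod ν).fst = μ := Measure.fst_prod
  have h2 : (μ.prod ν).snd = ν := Measure.snd_prod
  refine (iInf₂_le (μ.prod ν) ⟨h1, h2⟩).trans ?_
  calc ∫⁻ z, c z.1 z.2 ∂μ.prod ν ≤ ∫⁻ _, ENNReal.ofReal M ∂μ.prod ν :=
        lintegral_mono_ae ((ae_mem_prod_of_coupling (h1.symm ▸ hμ) (h2.symm ▸ hν)).mono
          fun z hz => hc _ hz.1 _ hz.2)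
    _ = ENNReal.ofReal M := by simp

/-- By the portmanteau theorem the mass of each set with null boundary converges. -/
theorem tendsto_sum_abs_sub_of_null_frontier {X α ι : Type*} [MeasurableSpace X]
    [TopologicalSpace X] [OpensMeasurableSpace X] [HasOuterApproxClosed X] [Fintype ι]
    {l : Filter α} {μ : α → ProbabilityMeasure X} {μ₀ : ProbabilityMeasure X}
    (h : Tendsto μ l (𝓝 μ₀)) {A : ι → Set X} (hA : ∀ i, (μ₀ : Measure X) (frontier (A i)) = 0) :
    Tendsto (fun a => ∑ i, |(μ₀ : Measure X).real (A i) - (μ a : Measure X).real (A i)|) l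
      (𝓝 0) := by
  have : Tendsto (fun a => ∑ i, |(μ₀ : Measure X).real (A i) - (μ a : Measure X).real (A i)|) l
      (𝓝 (∑ i : ι, |(μ₀ : Measure X).real (A i) - (μ₀ : Measure X).real (A i)|)) := by
    refine tendsto_finsetSum _ fun i _ => (tendsto_const_nhds.sub ?_).abs
    exact (ENNReal.tendsto_toReal (measure_ne_top _ _)).comp
      (ProbabilityMeasure.tendsto_measure_of_null_frontier_of_tendsto' h (hA i))
  simpa using this

theorem mainTheorem2 {V : Type*} [Finite V] (G : EmbeddedMetricGraph V)
    (μ ν : ℝ → ProbabilityMeasure E3) (μ₀ ν₀ : ProbabilityMeasure E3)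
    (hμ_ac : ∀ ε > 0, (μ ε : Measure E3) ≪ volume)
    (hν_ac : ∀ ε > 0, (ν ε : Measure E3) ≪ volume)
    (hμ_supp : ∀ ε > 0, (μ ε : Measure E3).support ⊆ G.network ε)
    (hν_supp : ∀ ε > 0, (ν ε : Measure E3).support ⊆ G.network ε)
    (hμ_lim : Tendsto μ (𝓝[>] 0) (𝓝 μ₀))
    (hν_lim : Tendsto ν (𝓝[>] 0) (𝓝 ν₀))
    (hμ₀_atomless : IsAtomless (μ₀ : Measure E3))
    (hν₀_atomless : IsAtomless (ν₀ : Measure E3))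
    (hμ₀_supp : (μ₀ : Measure E3).support ⊆ G.network 0)
    (hν₀_supp : (ν₀ : Measure E3).support ⊆ G.network 0) :
    Tendsto (fun ε : ℝ => OT (μ ε : Measure E3) (ν ε : Measure E3) (G.cost ε)) (𝓝[>] 0)
      (𝓝 (OT (μ₀ : Measure E3) (ν₀ : Measure E3) (G.cost 0))) := by

  have hae : ∀ (m : ProbabilityMeasure E3) {N : Set E3}, (m : Measure E3).support ⊆ N →
      ∀ᵐ x ∂(m : Measure E3), x ∈ N := fun m N h => mem_of_superset Measure.support_mem_ae h
  obtain ⟨M₀, hM₀⟩ := G.exists_costOn_carrier_bound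
  set M : ℝ := max M₀ 0 with hMdef
  have hM : ∀ p ∈ G.network 0, ∀ q ∈ G.network 0, G.cost 0 p q ≤ ENNReal.ofReal M := by
    intro p hp q hq
    change costOn (G.network 0) p q ≤ _
    rw [G.network_zero] at hp hq ⊢
    exact (hM₀ p hp q hq).trans (ENNReal.ofReal_le_ofReal (le_max_left _ _))
  have hμ₀ := hae μ₀ hμ₀_supp
  have hν₀ := hae ν₀ hν₀_supp
  have hfin : OT (μ₀ : Measure E3) (ν₀ : Measure E3) (G.cost 0) ≠ ⊤ :=
    ne_top_of_le_ne_top ENNReal.ofReal_ne_top (OT_le_ofReal hμ₀ hν₀ hM)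
  refine (ENNReal.tendsto_nhds hfin).2 fun e he => ?_
  -- The tolerance `e` may be infinite, so it is truncated. One half of `d` pays for the difference
  -- of the costs, the other for the change of cell masses.
  set d : ℝ := (min e 1).toReal with hd
  have hmint : min e 1 ≠ ⊤ := ne_top_of_le_ne_top ENNReal.one_ne_top (min_le_right _ _)
  have hd0 : 0 < d := ENNReal.toReal_pos (lt_min he one_pos).ne' hmint
  have hde : ENNReal.ofReal (d / 2) + ENNReal.ofReal (d / 2) ≤ e := by
    rw [← ENNReal.ofReal_add (by positivity) (by positivity), add_halves, hd,
      ENNReal.ofReal_toReal hmint]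
    exact min_le_left _ _
  obtain ⟨r, hr, hclose⟩ := G.exists_cost_close (half_pos hd0)
  -- The sum of the limits makes boundaries null for both at once; `N_1` contains every `N_ε` with
  -- `ε ≤ 1`.
  obtain ⟨t, k, hk, hk0, hkd⟩ := exists_cells ((μ₀ : Measure E3) + (ν₀ : Measure E3))
    (G.isCompact_network 1) hr
  simp only [Measure.coe_add, Pi.add_apply, add_eq_zero] at hk0
  have lμ := tendsto_sum_abs_sub_of_null_frontier hμ_lim fun σ => (hk0 σ).1
  have lν := tendsto_sum_abs_sub_of_null_frontier hν_lim fun σ => (hk0 σ).2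
  have lT := (lμ.add lν).const_mul (M + d / 2)
  rw [add_zero, mul_zero] at lT
  have hT := lT.eventually_lt_const (half_pos hd0)
  filter_upwards [hT, Ioo_mem_nhdsGT (lt_min hr one_pos)] with ε hTε hε
  have hε0 : 0 < ε := hε.1
  have hεr : ε < r := hε.2.trans_le (min_le_left _ _)
  have hε1 : ε ≤ 1 := hε.2.le.trans (min_le_right _ _)
  have hμ := hae (μ ε) (hμ_supp ε hε0)
  have hν := hae (ν ε) (hν_supp ε hε0)
  have hcl : ∀ x ∈ G.network ε, ∀ y ∈ G.network ε, ∀ x' ∈ G.network 0, ∀ y' ∈ G.network 0,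
      dist x x' < r → dist y y' < r →
        G.cost ε x y ≤ G.cost 0 x' y' + ENNReal.ofReal (d / 2) ∧
          G.cost 0 x' y' ≤ G.cost ε x y + ENNReal.ofReal (d / 2) := by
    rw [G.network_zero]
    exact hclose ε hε0.le hεr
  have hdist : ∀ x ∈ G.network ε, ∀ x', k x = k x' → dist x x' < r := fun x hx =>
    hkd x (G.network_mono hε1 hx)
  -- Comparison with points of the graph within distance `ε` makes `M + d / 2` a bound for `c_ε` on
  -- `N_ε`.
  have hMε : ∀ x ∈ G.network ε, ∀ y ∈ G.network ε,
      G.cost ε x y ≤ ENNReal.ofReal (M + d / 2) := by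
    intro x hx y hy
    obtain ⟨p, hp, hxp⟩ := G.mem_network_iff.1 hx
    obtain ⟨q, hq, hyq⟩ := G.mem_network_iff.1 hy
    rw [← G.network_zero] at hp hq
    rw [ENNReal.ofReal_add (le_max_right _ _) (by positivity)]
    exact (hcl x hx y hy p hp q hq (hxp.trans_lt hεr) (hyq.trans_lt hεr)).1.trans
      (add_le_add (hM p hp q hq) le_rfl)
  have up := OT_le_of_cells (μ₀ : Measure E3) (ν₀ : Measure E3) (μ ε : Measure E3)
    (ν ε : Measure E3) hk hμ₀ hν₀ hμ hν (G.cost 0) (G.cost ε) (ENNReal.ofReal (d / 2))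
    (M + d / 2) hMε fun x' hx' y' hy' x hx y hy hkx hky =>
      (hcl x hx y hy x' hx' y' hy' (hdist x hx x' hkx.symm) (hdist y hy y' hky.symm)).1
  have down := OT_le_of_cells (μ ε : Measure E3) (ν ε : Measure E3) (μ₀ : Measure E3)
    (ν₀ : Measure E3) hk hμ hν hμ₀ hν₀ (G.cost ε) (G.cost 0) (ENNReal.ofReal (d / 2))
    (M + d / 2) (fun p hp q hq => (hM p hp q hq).trans (ENNReal.ofReal_le_ofReal (by linarith)))
    fun x hx y hy x' hx' y' hy' hkx hky =>
      (hcl x hx y hy x' hx' y' hy' (hdist x hx x' hkx) (hdist y hy y' hky)).2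
  simp only [abs_sub_comm ((μ ε : Measure E3).real _), abs_sub_comm ((ν ε : Measure E3).real _)]
    at down
  have hTle := (add_le_add_right (ENNReal.ofReal_le_ofReal hTε.le)
    (ENNReal.ofReal (d / 2))).trans hde
  exact ⟨tsub_le_iff_right.2 (down.trans (add_le_add le_rfl hTle)),
    up.trans (add_le_add le_rfl hTle)⟩
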